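/- Setting. A \emph{finitely ramified cell structure} on a compact metric space $F$ consists of families of cells $\{F_\alpha\}_{\alpha\in\mathcal A}$ and vertex boundaries $\{V_\alpha\}_{\alpha\in\mathcal A}$ with $\mathcal A$ countable, such that: the $F_\alpha\subset F$ are distinct, compact and connected; each $V_\alpha\subset F_\alpha$ is finite with at least two points; if $F_\alpha=\bigcup_{j=1}^kF_{\alpha_j}$ then $V_\alpha\subset\bigcup_{j=1}^kV_{\alpha_j}$; $\mathcal A$ is the disjoint union of finite sets $\mathcal A_n$, $n\ge 0$, with $\mathcal A_0=\{0\}$, $F_0=F$, and every $F_\alpha$ with $\alpha\in\mathcal A_n$ is a finite union of cells $F_\beta$ with $\beta\in\mathcal A_{n+1}$; $F_\alpha\cap F_{\alpha'}=V_\alpha\cap V_{\alpha'}$ for distinct $\alpha,\alpha'\in\mathcal A_n$; and every strictly decreasing sequence of cells intersects in exactly one point. Put $V_n=\bigcup_{\alpha\in\mathcal A_n}V_\alpha$ and $V_*=\bigcup_nV_n$. Let $(\mathcal E,\operatorname{Dom}\mathcal E)$ be a resistance form on $V_*$ in the sense of Kigami: $\operatorname{Dom}\mathcal E$ is a linear space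 of real functions on $V_*$ containing the constants; $\mathcal E$ is a nonnegative symmetric bilinear form on it with $\mathcal E(u,u)=0$ iff $u$ is constant; $\operatorname{Dom}\mathcal E$ modulo constants is complete in the energy norm; every function on a finite subset of $V_*$ extends to an element of $\operatorname{Dom}\mathcal E$; $R(p,q)=\sup\{(u(p)-u(q))^2/\mathcal E(u,u):u\in\operatorname{Dom}\mathcal E,\ \mathcal E(u,u)>0\}<\infty$ for all $p,q\in V_*$; and $\bar u=\max(0,\min(1,u))$ belongs to $\operatorname{Dom}\mathcal E$ with $\mathcal E(\bar u,\bar u)\le\mathcal E(u,u)$ for all $u\in\operatorname{Dom}\mathcal E$. Assume that $\mathcal E$ respects the cell structure: there are quadratic forms $Q_\alpha$ on the spaces of functions on $V_\alpha$ such that for all $n$ and all $f:V_*\to\mathbb R$ $$\inf\{\mathcal E(g,g):g\in\operatorname{Dom}\mathcal E,\ g|_{V_n}=f|_{V_n}\}=\sum_{\alpha\in\mathcal A_n}Q_\alpha(f|_{V_\alpha}).$$ The effective resistance $R$ is a metric on $V_*$; let $\Omega$ be the $R$-completion of $V_*$. Every $u\in\operatorname{Dom}\mathcal E$ extends uniquely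 to an $R$-continuous function $\tilde u$ on $\Omega$. A function in $\operatorname{Dom}\mathcal E$ is \emph{$n$-harmonic} if it minimizes the energy for its given values on $V_n$; it is called continuous if it is the restriction to $V_*$ of a continuous function on $F$. Definitions. On a locally compact separable metric space $X$ with a Radon measure $\nu$ of full support, a \emph{Dirichlet form} on $L^2(X,\nu)$ is a densely defined, nonnegative, symmetric, closed and Markovian form. It is \emph{regular} if the continuous compactly supported elements of its domain are dense in the domain in the norm $(\mathcal E(u,u)+\|u\|_{L^2}^2)^{1/2}$ and uniformly dense in the continuous functions with compact support; it is \emph{local} if $\mathcal E(u,v)=0$ whenever $u,v$ in the domain have disjoint compact supports. The notions of Dirichlet form and of locality are also used on $(\Omega,R)$ without local compactness. Theorem. Suppose that, for all $n\ge0$, all $n$-harmonic functions are continuous. Then there is a continuous injective map $\theta:\Omega\to F$ which is the identity on $V_*$, by which $\Omega$ is regarded as a subset of $F$, and for every finite Borel measure $\mu$ on $\Omega$ that charges every nonempty ($R$-)open set the following hold. 1. The form $\mathcal E$ with domain $\{\tilde u:u\in\operatorname{Dom}\mathcal E\}\cap L^2(\Omega,\mu)$ is well defined on $L^2(\Omega,\mu)$,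 and it is a Dirichlet form, local with respect to the topology of $(\Omega,R)$. If $\Omega$ is $R$-compact, it is a local regular Dirichlet form on $(\Omega,R)$. 2. With respect to the topology of $F$, $\mathcal E$ is always a local regular Dirichlet form: regarding $\mu$ as the measure $\theta_*\mu$ on $F$, which is carried by $\Omega$ and has full support, the form $\mathcal E$ with domain $\{f\in L^2(F,\theta_*\mu): f\circ\theta=\tilde u\ \ \mu\text{-a.e. for some }u\in\operatorname{Dom}\mathcal E\}$ is well defined and is a local regular Dirichlet form on $L^2(F,\theta_*\mu)$. -/

import Mathlib

open Set Filter Topology MeasureTheory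

noncomputable section

/-! ### Resistance forms -/

/-- The unit contraction `t ↦ (0 ∨ t) ∧ 1` of the real line. -/
def unitClip (t : ℝ) : ℝ := max 0 (min 1 t)

/-- A resistance form `(𝓔, Dom 𝓔)` on a set `V`, in the sense of Kigami. -/
structure ResistanceForm (V : Type*) where
  /-- the domain `Dom 𝓔`, a linear space of real functions on `V` -/
  dom : Submodule ℝ (V → ℝ)
  /-- the bilinear form `𝓔(u, v)` -/
  form : dom →ₗ[ℝ] dom →ₗ[ℝ] ℝ
  const_mem : ∀ c : ℝ, (fun _ => c) ∈ dom
  symm : ∀ u v, form u v = form v u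
  nonneg : ∀ u, 0 ≤ form u u
  eq_zero_iff : ∀ u : dom, form u u = 0 ↔ ∃ c : ℝ, ∀ p, (u : V → ℝ) p = c
  /-- `Dom 𝓔` modulo constants is complete in the energy norm -/
  complete : ∀ u : ℕ → dom,
    (∀ ε > 0, ∃ N, ∀ m ≥ N, ∀ n ≥ N, form (u m - u n) (u m - u n) < ε) →
    ∃ w : dom, Tendsto (fun n => form (u n - w) (u n - w)) atTop (𝓝 0)
  /-- every function on a finite subset extends to an element of the domain -/
  exists_extension : ∀ (s : Finset V) (v : V → ℝ), ∃ u : dom, ∀ p ∈ s, (u : V → ℝ) p = v p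
  /-- the effective resistances are finite -/
  resistance_finite : ∀ p q : V, BddAbove
    {r : ℝ | ∃ u : dom, 0 < form u u ∧ r = ((u : V → ℝ) p - (u : V → ℝ) q) ^ 2 / form u u}
  /-- the Markov property -/
  markov : ∀ u : dom, ∃ h : (fun p => unitClip ((u : V → ℝ) p)) ∈ dom,
    form ⟨_, h⟩ ⟨_, h⟩ ≤ form u u

namespace ResistanceForm

variable {V : Type*} (E : ResistanceForm V)

/-- The effective resistance `R(p, q)`. -/
def resistance (p q : V) : ℝ :=
  sSup {r : ℝ | ∃ u : E.dom, 0 < E.form u u ∧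
    r = ((u : V → ℝ) p - (u : V → ℝ) q) ^ 2 / E.form u u}

theorem resistance_nonneg (p q : V) : 0 ≤ E.resistance p q := by
  apply Real.sSup_nonneg
  rintro r ⟨u, hu, rfl⟩
  positivity

theorem sq_sub_le (u : E.dom) (p q : V) :
    ((u : V → ℝ) p - (u : V → ℝ) q) ^ 2 ≤ E.resistance p q * E.form u u := by
  rcases (E.nonneg u).eq_or_lt with h | h
  · obtain ⟨c, hc⟩ := (E.eq_zero_iff u).1 h.symm
    simp [hc, ← h]
  · rw [← div_le_iff₀ h]
    exact le_csSup (E.resistance_finite p q) ⟨u, h, rfl⟩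

theorem resistance_self (p : V) : E.resistance p p = 0 := by
  apply le_antisymm _ (E.resistance_nonneg p p)
  apply Real.sSup_le _ le_rfl
  rintro r ⟨u, hu, rfl⟩
  simp

theorem resistance_comm (p q : V) : E.resistance p q = E.resistance q p := by
  unfold resistance
  congr 1
  ext r
  constructor <;> rintro ⟨u, hu, rfl⟩ <;> exact ⟨u, hu, by ring⟩

theorem eq_of_resistance_eq_zero {p q : V} (h : E.resistance p q = 0) : p = q := by
  classical
  by_contra hpq
  obtain ⟨u, hu⟩ := E.exists_extension {p, q} (fun x => if x = p then 1 else 0)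
  have h1 := hu p (by simp)
  have h2 := hu q (by simp)
  have := E.sq_sub_le u p q
  rw [h, h1, h2] at this
  simp [Ne.symm hpq] at this
  norm_num at this

theorem form_clip_le (u : E.dom) (hu : ∀ p, 0 ≤ (u : V → ℝ) p) {a : ℝ} (ha : 0 < a) :
    ∃ v : E.dom, (∀ p, (v : V → ℝ) p = min a ((u : V → ℝ) p)) ∧ E.form v v ≤ E.form u u := by
  obtain ⟨h, hle⟩ := E.markov (a⁻¹ • u)
  refine ⟨a • ⟨_, h⟩, fun p => ?_, ?_⟩
  · have hp := hu p
    have : a * min 1 (a⁻¹ * (u : V → ℝ) p) = min a ((u : V → ℝ) p) := by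
      rw [mul_min_of_nonneg _ _ ha.le]
      congr 1
      · ring
      · field_simp
    simp only [Submodule.coe_smul, Pi.smul_apply, smul_eq_mul, unitClip]
    rw [max_eq_right (by positivity), this]
  · simp only [map_smul, LinearMap.smul_apply, smul_eq_mul] at hle ⊢
    calc _ ≤ a * (a * (a⁻¹ * (a⁻¹ * E.form u u))) := by gcongr
      _ = _ := by field_simp

/-- Cutting `u ≥ 0` at height `a` splits the energy superadditively. -/
theorem form_split (u : E.dom) (hu : ∀ p, 0 ≤ (u : V → ℝ) p) {a : ℝ} (ha : 0 < a) :
    ∃ v : E.dom, (∀ p, (v : V → ℝ) p = min a ((u : V → ℝ) p)) ∧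
      E.form v v + E.form (u - v) (u - v) ≤ E.form u u := by
  obtain ⟨v, hv, -⟩ := E.form_clip_le u hu ha
  refine ⟨v, hv, ?_⟩
  have key : ∀ t : ℝ, 0 < t →
      0 ≤ 2 * t * E.form v (u - v) + t ^ 2 * E.form (u - v) (u - v) := by
    intro t ht
    have hw : ∀ p, ((v + t • (u - v) : E.dom) : V → ℝ) p
        = min a ((u : V → ℝ) p) + t * ((u : V → ℝ) p - min a ((u : V → ℝ) p)) := by
      intro p; simp [hv]
    obtain ⟨v', hv', hle⟩ := E.form_clip_le (v + t • (u - v)) (fun p => by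
      rw [hw]
      have h1 : 0 ≤ min a ((u : V → ℝ) p) := le_min ha.le (hu p)
      have h2 := min_le_right a ((u : V → ℝ) p)
      have := mul_nonneg ht.le (sub_nonneg.2 h2)
      linarith) ha
    have hvv : v' = v := by
      ext p
      rw [hv', hw, hv]
      rcases le_total a ((u : V → ℝ) p) with h | h
      · rw [min_eq_left h, min_eq_left]
        have := mul_nonneg ht.le (sub_nonneg.2 h)
        linarith
      · simp [h]
    rw [hvv] at hle
    simp only [map_add, map_smul, LinearMap.add_apply, LinearMap.smul_apply, smul_eq_mul] at hle
    rw [E.symm (u - v) v] at hle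
    nlinarith
  have hc : 0 ≤ E.form v (u - v) := by
    by_contra hneg
    push Not at hneg
    set b := E.form (u - v) (u - v)
    have hb : 0 ≤ b := E.nonneg _
    have ht : 0 < -E.form v (u - v) / (b + 1) := by
      apply div_pos <;> linarith
    have := key _ ht
    set t := -E.form v (u - v) / (b + 1)
    have e : E.form v (u - v) = -(t * (b + 1)) := by
      simp only [t]; field_simp
    rw [e] at this
    nlinarith [mul_pos ht ht, mul_nonneg (mul_pos ht ht).le hb]
  have hu' : E.form u u = E.form v v + 2 * E.form v (u - v) + E.form (u - v) (u - v) := by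
    have h3 := E.symm u v
    simp only [map_sub, LinearMap.sub_apply]
    linarith
  linarith

theorem resistance_triangle (p r q : V) :
    E.resistance p q ≤ E.resistance p r + E.resistance r q := by
  have hpr := E.resistance_nonneg p r
  have hrq := E.resistance_nonneg r q
  refine Real.sSup_le ?_ (by linarith)
  rintro x ⟨u, hu, rfl⟩
  rw [div_le_iff₀ hu]
  set d := (u : V → ℝ) p - (u : V → ℝ) q with hd
  rcases eq_or_ne d 0 with h0 | h0
  · rw [h0]; nlinarith
  -- normalise so that the values at `q` and `p` are `0` and `1`, and clip
  let k : E.dom := ⟨fun _ => (u : V → ℝ) q, E.const_mem _⟩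
  have hk0 : E.form k k = 0 := (E.eq_zero_iff k).2 ⟨_, fun _ => rfl⟩
  have hku : E.form (u - k) (u - k) = E.form u u := by
    have hz : E.form k u = 0 := by
      have h1 : ∀ t : ℝ, 0 ≤ E.form u u + 2 * t * E.form k u := by
        intro t
        have := E.nonneg (u + t • k)
        simp only [map_add, map_smul, LinearMap.add_apply, LinearMap.smul_apply, smul_eq_mul,
          hk0, E.symm u k] at this
        linarith
      by_contra hne
      have := h1 (-(E.form u u + 1) / (2 * E.form k u))
      have e : 2 * (-(E.form u u + 1) / (2 * E.form k u)) * E.form k u = -(E.form u u + 1) := by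
        field_simp
      rw [e] at this
      linarith
    have hz' : E.form u k = 0 := by rw [E.symm]; exact hz
    simp [hk0, hz, hz']
  obtain ⟨hw, hwle⟩ := E.markov (d⁻¹ • (u - k))
  set w : E.dom := ⟨_, hw⟩ with hwdef
  have hwle' : E.form w w * d ^ 2 ≤ E.form u u := by
    have e : E.form (d⁻¹ • (u - k)) (d⁻¹ • (u - k)) = E.form u u / d ^ 2 := by
      rw [← hku]
      simp only [map_smul, LinearMap.smul_apply, smul_eq_mul]
      field_simp
    rw [e] at hwle
    have hd2 : 0 < d ^ 2 := by positivity
    rwa [le_div_iff₀ hd2] at hwle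
  have hwp : (w : V → ℝ) p = 1 := by
    have : d⁻¹ * ((u : V → ℝ) p - (u : V → ℝ) q) = 1 := by rw [← hd]; field_simp
    simp [hwdef, unitClip, k, this]
  have hwq : (w : V → ℝ) q = 0 := by
    simp [hwdef, unitClip, k]
  have hw0 : ∀ x, 0 ≤ (w : V → ℝ) x := fun x => by simp [hwdef, unitClip]
  have hw1 : ∀ x, (w : V → ℝ) x ≤ 1 := fun x => by simp [hwdef, unitClip]
  have main : 1 ≤ (E.resistance p r + E.resistance r q) * E.form w w := by
    rcases (hw0 r).eq_or_lt with ha | ha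
    · have h1 := E.sq_sub_le w p r
      rw [hwp, ← ha] at h1
      nlinarith [E.nonneg w, mul_nonneg hrq (E.nonneg w)]
    · obtain ⟨v, hv, hle⟩ := E.form_split w hw0 ha
      have h1 := E.sq_sub_le v r q
      have h2 := E.sq_sub_le (w - v) p r
      have hr1 := hw1 r
      simp only [Submodule.coe_sub, Pi.sub_apply, hv, hwp, hwq, min_self, min_eq_left hr1,
        min_eq_right ha.le, sub_self, sub_zero] at h1 h2
      set a := (w : V → ℝ) r
      set x := E.form v v
      set y := E.form (w - v) (w - v)
      have hx : 0 ≤ x := E.nonneg _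
      have hy : 0 ≤ y := E.nonneg _
      set A := E.resistance p r
      set B := E.resistance r q
      have h3 : 1 ≤ (A + B) * (x + y) := by
        have hb : (a * (1 - a)) ^ 2 ≤ (B * x) * (A * y) := by
          have := mul_le_mul h1 h2 (sq_nonneg _) (by positivity)
          nlinarith
        have hc : 2 * (a * (1 - a)) ≤ A * x + B * y := by
          have hn : 0 ≤ A * x + B * y := by positivity
          refine le_of_sq_le_sq ?_ hn
          nlinarith [sq_nonneg (A * x - B * y)]
        nlinarith
      have := mul_le_mul_of_nonneg_left hle (add_nonneg hpr hrq)
      linarith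
  have hd2 : 0 < d ^ 2 := by positivity
  have := mul_le_mul_of_nonneg_left hwle' (add_nonneg hpr hrq)
  nlinarith

/-- The set `V`, equipped with the effective resistance metric of `E`. -/
def Space (_E : ResistanceForm V) : Type _ := V

instance : MetricSpace E.Space where
  dist p q := E.resistance p q
  dist_self p := E.resistance_self p
  dist_comm p q := E.resistance_comm p q
  dist_triangle p r q := E.resistance_triangle p r q
  eq_of_dist_eq_zero h := E.eq_of_resistance_eq_zero h

/-- `Ω`, the completion of `V` in the effective resistance metric. -/
abbrev Omega : Type _ := UniformSpace.Completion E.Space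

/-- The canonical inclusion of `V` into `Ω`. -/
def toOmega (p : V) : E.Omega := UniformSpace.Completion.coe' (α := E.Space) p

instance : MeasurableSpace E.Omega := borel _

instance : BorelSpace E.Omega := ⟨rfl⟩

theorem uniformContinuous (u : E.dom) :
    UniformContinuous (fun p : E.Space => (u : V → ℝ) p) := by
  rw [Metric.uniformContinuous_iff]
  intro ε hε
  have hu := E.nonneg u
  refine ⟨ε ^ 2 / (E.form u u + 1), by positivity, fun {p q} h => ?_⟩
  have h1 := E.sq_sub_le u p q
  have h2 : E.resistance p q < ε ^ 2 / (E.form u u + 1) := h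
  rw [lt_div_iff₀ (by positivity)] at h2
  have h3 := E.resistance_nonneg p q
  rw [Real.dist_eq]
  apply abs_lt_of_sq_lt_sq _ hε.le
  nlinarith

/-- The unique continuous extension to `Ω` of a function `u` in the domain. -/
def ext (u : E.dom) : E.Omega → ℝ :=
  UniformSpace.Completion.extension (fun p : E.Space => (u : V → ℝ) p)

theorem ext_toOmega (u : E.dom) (p : V) : E.ext u (E.toOmega p) = (u : V → ℝ) p :=
  UniformSpace.Completion.extension_coe (α := E.Space) (E.uniformContinuous u) p

theorem continuous_ext (u : E.dom) : Continuous (E.ext u) :=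
  UniformSpace.Completion.continuous_extension

/-- The trace of `E` on `U ⊆ V`, at a function `f` (it depends only on `f` on `U`):
`inf {𝓔(g, g) : g ∈ Dom 𝓔, g = f on U}`. -/
def trace (U : Set V) (f : V → ℝ) : ℝ :=
  sInf {r : ℝ | ∃ g : E.dom, (∀ p ∈ U, (g : V → ℝ) p = f p) ∧ r = E.form g g}

/-- `u` minimizes the energy among all functions in the domain with the same values on `U`. -/
def IsEnergyMinimizer (U : Set V) (u : E.dom) : Prop :=
  ∀ g : E.dom, (∀ p ∈ U, (g : V → ℝ) p = (u : V → ℝ) p) → E.form u u ≤ E.form g g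

end ResistanceForm

/-! ### Finitely ramified cell structures -/

/-- A finitely ramified cell structure on a (compact metric) space `F`, with cells `cell α`,
vertex boundaries `vert α`, and a filtration of the index set `A` by the finite sets `level n`. -/
structure FinitelyRamifiedCellStructure (F : Type*) [MetricSpace F] (A : Type*) where
  cell : A → Set F
  vert : A → Set F
  level : ℕ → Finset A
  root : A
  countable_index : Countable A
  cell_injective : Function.Injective cell
  isCompact_cell : ∀ α, IsCompact (cell α)
  isConnected_cell : ∀ α, IsConnected (cell α)
  vert_subset : ∀ α, vert α ⊆ cell α
  finite_vert : ∀ α, (vert α).Finite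
  nontrivial_vert : ∀ α, (vert α).Nontrivial
  vert_subset_of_cell_eq : ∀ (α : A) (s : Finset A), cell α = ⋃ β ∈ s, cell β →
    vert α ⊆ ⋃ β ∈ s, vert β
  level_zero : level 0 = {root}
  cell_root : cell root = univ
  level_disjoint : ∀ m n, m ≠ n → Disjoint (level m) (level n)
  exists_level : ∀ α, ∃ n, α ∈ level n
  cell_eq_iUnion : ∀ n, ∀ α ∈ level n, ∃ s ⊆ level (n + 1), cell α = ⋃ β ∈ s, cell β
  cell_inter : ∀ n, ∀ α ∈ level n, ∀ β ∈ level n, α ≠ β →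
    cell α ∩ cell β = vert α ∩ vert β
  iInter_cell : ∀ a : ℕ → A, StrictAnti (fun n => cell (a n)) → ∃ x, ⋂ n, cell (a n) = {x}

namespace FinitelyRamifiedCellStructure

variable {F : Type*} [MetricSpace F] {A : Type*} (C : FinitelyRamifiedCellStructure F A)

/-- `V_*`, the set of all vertices. -/
def vertices : Set F := ⋃ α, C.vert α

/-- `V_n`, the set of the vertices of the `n`-cells, as a subset of `V_*`. -/
def verticesAt (n : ℕ) : Set C.vertices := {p | ∃ α ∈ C.level n, (p : F) ∈ C.vert α}

/-- The restriction to `V_α` of a function on `V_*`. -/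
def restrictVert (α : A) (f : C.vertices → ℝ) : C.vert α → ℝ :=
  fun p => f ⟨p, mem_iUnion.2 ⟨α, p.2⟩⟩

/-- The resistance form `E` respects the cell structure: there are energies `Q α` on the finite
sets `V_α` such that for every `n` the trace `𝓔_n` of `𝓔` on `V_n` is the sum of the energies of
the `n`-cells. -/
def IsCompatible (E : ResistanceForm C.vertices) : Prop :=
  ∃ Q : ∀ α : A, QuadraticForm ℝ (C.vert α → ℝ), ∀ (n : ℕ) (f : C.vertices → ℝ),
    E.trace (C.verticesAt n) f = ∑ α ∈ C.level n, Q α (C.restrictVert α f)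

/-- `n`-harmonic functions: energy minimizers for given values on `V_n`. -/
def IsHarmonic (E : ResistanceForm C.vertices) (n : ℕ) (u : E.dom) : Prop :=
  E.IsEnergyMinimizer (C.verticesAt n) u

end FinitelyRamifiedCellStructure

/-! ### Dirichlet forms -/

/-- A bilinear form defined on a linear subspace of `L²(X, μ)`. -/
structure L2Form {X : Type*} [MeasurableSpace X] (μ : Measure X) where
  dom : Submodule ℝ (Lp ℝ 2 μ)
  form : dom →ₗ[ℝ] dom →ₗ[ℝ] ℝ

namespace L2Form

variable {X : Type*} [MeasurableSpace X] {μ : Measure X} (D : L2Form μ)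

/-- `𝓔₁(u, u) = 𝓔(u, u) + ‖u‖²`. -/
def energyOne (u : D.dom) : ℝ := D.form u u + ‖(u : Lp ℝ 2 μ)‖ ^ 2

/-- A Dirichlet form: densely defined, symmetric, nonnegative, closed and Markovian. -/
structure IsDirichletForm : Prop where
  dense : Dense (D.dom : Set (Lp ℝ 2 μ))
  symm : ∀ u v, D.form u v = D.form v u
  nonneg : ∀ u, 0 ≤ D.form u u
  closed : ∀ u : ℕ → D.dom,
    (∀ ε > 0, ∃ N, ∀ m ≥ N, ∀ n ≥ N, D.energyOne (u m - u n) < ε) →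
    ∃ w : D.dom, Tendsto (fun n => D.energyOne (u n - w)) atTop (𝓝 0)
  markov : ∀ u : D.dom, ∃ v : D.dom,
    (v : Lp ℝ 2 μ) =ᵐ[μ] (fun x => unitClip ((u : Lp ℝ 2 μ) x)) ∧ D.form v v ≤ D.form u u

/-- `φ` is a continuous version of `u` with compact support. -/
def IsVersion [TopologicalSpace X] (u : D.dom) (φ : X → ℝ) : Prop :=
  Continuous φ ∧ HasCompactSupport φ ∧ (u : Lp ℝ 2 μ) =ᵐ[μ] φ

/-- Regularity of a form on a locally compact space with a Radon measure of full support: the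
domain elements that are continuous with compact support are dense in the domain, in the norm of
`𝓔₁`, and dense in the continuous functions with compact support, in the uniform norm. -/
structure IsRegular [TopologicalSpace X] : Prop where
  locallyCompact : LocallyCompactSpace X
  finite_on_compacts : IsFiniteMeasureOnCompacts μ
  open_pos : μ.IsOpenPosMeasure
  dense_dom : ∀ (u : D.dom), ∀ ε > 0, ∃ (v : D.dom) (φ : X → ℝ),
    D.IsVersion v φ ∧ D.energyOne (u - v) < ε
  dense_continuous : ∀ ψ : X → ℝ, Continuous ψ → HasCompactSupport ψ → ∀ ε > 0,
    ∃ (v : D.dom) (φ : X → ℝ), D.IsVersion v φ ∧ ∀ x, |ψ x - φ x| < ε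

/-- Locality: `𝓔(u, v) = 0` if `u` and `v` have disjoint compact supports, that is, if they vanish
almost everywhere outside disjoint compact sets. -/
def IsLocal [TopologicalSpace X] : Prop :=
  ∀ (u v : D.dom) (K L : Set X), IsCompact K → IsCompact L → Disjoint K L →
    (∀ᵐ x ∂μ, x ∉ K → (u : Lp ℝ 2 μ) x = 0) → (∀ᵐ x ∂μ, x ∉ L → (v : Lp ℝ 2 μ) x = 0) →
    D.form u v = 0

end L2Form

/-- `D` is the resistance form `E`, seen as a form in `L²(X, ν)`, where `j : Ω → X` and `ν` is the
image under `j` of a measure `μ` on `Ω`: the domain consists of all square integrable `f` for which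
`f ∘ j` is (almost everywhere) the extension to `Ω` of some `u ∈ Dom 𝓔`, and the energies agree. -/
def ResistanceForm.IsRealizedBy {V X : Type*} [MeasurableSpace X] (E : ResistanceForm V)
    (μ : Measure E.Omega) (j : E.Omega → X) {ν : Measure X} (D : L2Form ν) : Prop :=
  (∀ f : Lp ℝ 2 ν, f ∈ D.dom ↔ ∃ u : E.dom, (fun x => f (j x)) =ᵐ[μ] E.ext u) ∧
  ∀ (f g : D.dom) (u v : E.dom),
    (fun x => (f : Lp ℝ 2 ν) (j x)) =ᵐ[μ] E.ext u →
    (fun x => (g : Lp ℝ 2 ν) (j x)) =ᵐ[μ] E.ext v →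
    D.form f g = E.form u v

end

/-! Compatibility gives locality at the level of cells. If `u` is `n`-harmonic, `w` is the
`n`-harmonic function with the values of `v` on `V_n`, and on each `n`-cell one of `u`, `w` vanishes
at the boundary, then `u + w` and `u - w` agree up to sign on each boundary. The cell energies are
even, so these functions have equal energy and `E.form u v = E.form u w = 0`. Hence a harmonic
function that is constant at the boundary of a cell is constant in the cell
(`IsHarmonic.eq_const_of_mem_cell`). Cells shrink uniformly, by König's lemma, so the continuous
harmonic functions separate the points of `F`.

This produces `θ`: as vertices tend to `ω ∈ Ω` in resistance, their cluster points `x` in the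
compact space `F` satisfy `φ x = E.ext u ω` for every harmonic `u` with continuous extension `φ`, so
only one is possible. It is injective because `Dom 𝓔` separates `Ω` and harmonic functions are dense
in energy.

On `L²`, full support makes the representing function in `Dom 𝓔` unique. Closedness comes from
completeness modulo constants, an almost everywhere limit fixing the constant. The continuous
functions on `F` that pull back to `Dom 𝓔` form a separating vector lattice with constants, so
Stone-Weierstrass yields uniform density and then `L²` density. Functions with supports in disjoint
compact sets are never both nonzero on a small cell, hence locality. For regularity, truncation
followed by harmonic approximation (`exists_harmonic_near`) gives density in `𝓔₁`.

Both topologies are treated at once, through a Polish space `X` with continuous maps `j : Ω → X` and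
injective `i : X → F`. -/

noncomputable section

/-! ### Energy estimates and energy minimizers -/

namespace ResistanceForm

variable {V : Type*} (E : ResistanceForm V)

/-- The constant function `c`, as an element of the domain. -/
def const (c : ℝ) : E.dom := ⟨fun _ => c, E.const_mem c⟩

@[simp] theorem const_apply (c : ℝ) (p : V) : (E.const c : V → ℝ) p = c := rfl

theorem form_sq_le (u v : E.dom) : E.form u v ^ 2 ≤ E.form u u * E.form v v :=
  LinearMap.BilinForm.apply_sq_le_of_symm E.form E.nonneg ⟨E.symm⟩ u v

theorem form_const_left (c : ℝ) (u : E.dom) : E.form (E.const c) u = 0 := by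
  have h := E.form_sq_le (E.const c) u
  rw [(E.eq_zero_iff (E.const c)).2 ⟨c, fun _ => rfl⟩, zero_mul] at h
  exact pow_eq_zero_iff two_ne_zero |>.1 (le_antisymm h (sq_nonneg _))

theorem form_const_right (c : ℝ) (u : E.dom) : E.form u (E.const c) = 0 := by
  rw [E.symm, E.form_const_left]

theorem form_add_self (u v : E.dom) :
    E.form (u + v) (u + v) = E.form u u + 2 * E.form u v + E.form v v := by
  simp only [map_add, LinearMap.add_apply, E.symm v u]; ring

theorem form_sub_self (u v : E.dom) :
    E.form (u - v) (u - v) = E.form u u - 2 * E.form u v + E.form v v := by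
  simp only [map_sub, LinearMap.sub_apply, E.symm v u]; ring

theorem form_sub_comm (u v : E.dom) : E.form (u - v) (u - v) = E.form (v - u) (v - u) := by
  rw [form_sub_self, form_sub_self, E.symm u v]; ring

theorem form_add_self_le (u v : E.dom) :
    E.form (u + v) (u + v) ≤ 2 * E.form u u + 2 * E.form v v := by
  have := E.nonneg (u - v)
  rw [form_sub_self] at this
  rw [form_add_self]; linarith

theorem form_sub_self_le (u v w : E.dom) :
    E.form (u - w) (u - w) ≤ 2 * E.form (u - v) (u - v) + 2 * E.form (v - w) (v - w) := by
  have := E.form_add_self_le (u - v) (v - w)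
  rwa [sub_add_sub_cancel] at this

theorem form_sub_const (u : E.dom) (c : ℝ) :
    E.form (u - E.const c) (u - E.const c) = E.form u u := by
  rw [form_sub_self, form_const_right, form_const_right]; ring

theorem form_add_const (u : E.dom) (c : ℝ) :
    E.form (u + E.const c) (u + E.const c) = E.form u u := by
  rw [form_add_self, form_const_right, form_const_right]; ring

/-- Elements of the domain are stable under truncation to an interval, which lowers the energy. -/
theorem exists_truncation (u : E.dom) {a b : ℝ} (hab : a < b) :
    ∃ v : E.dom, (∀ p, (v : V → ℝ) p = max a (min b ((u : V → ℝ) p))) ∧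
      E.form v v ≤ E.form u u := by
  have hd : 0 < b - a := sub_pos.2 hab
  obtain ⟨h, hle⟩ := E.markov ((b - a)⁻¹ • (u - E.const a))
  refine ⟨(b - a) • ⟨_, h⟩ + E.const a, fun p => ?_, ?_⟩
  · simp only [Submodule.coe_add, Submodule.coe_smul, Submodule.coe_sub, Pi.add_apply,
      Pi.smul_apply, Pi.sub_apply, smul_eq_mul, unitClip, const_apply]
    have e : (b - a) * ((b - a)⁻¹ * ((u : V → ℝ) p - a)) = (u : V → ℝ) p - a := by
      field_simp
    rw [mul_max_of_nonneg _ _ hd.le, mul_min_of_nonneg _ _ hd.le, e, mul_zero, mul_one,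
      ← max_add_add_right, ← min_add_add_right]
    simp
  · rw [form_add_const]
    simp only [map_smul, LinearMap.smul_apply, smul_eq_mul] at hle ⊢
    rw [form_sub_const] at hle
    calc _ ≤ (b - a) * ((b - a) * ((b - a)⁻¹ * ((b - a)⁻¹ * E.form u u))) := by gcongr
      _ = _ := by field_simp

theorem tendsto_form_left {u : ℕ → E.dom} {w : E.dom}
    (h : Tendsto (fun n => E.form (u n - w) (u n - w)) atTop (𝓝 0)) (v : E.dom) :
    Tendsto (fun n => E.form (u n) v) atTop (𝓝 (E.form w v)) := by
  rw [tendsto_iff_dist_tendsto_zero]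
  have h1 : Tendsto (fun n => √(E.form (u n - w) (u n - w) * E.form v v)) atTop (𝓝 0) := by
    have := (h.mul_const (E.form v v)).sqrt
    simpa using this
  refine squeeze_zero (fun _ => dist_nonneg) (fun n => ?_) h1
  rw [Real.dist_eq]
  apply Real.abs_le_sqrt
  have := E.form_sq_le (u n - w) v
  simpa using this

/-- Energy convergence sees functions only modulo constants. Finite resistance gives convergence of
differences of values; the additive constant has to be fixed separately. -/
theorem tendsto_sub_sub {u : ℕ → E.dom} {w : E.dom}
    (h : Tendsto (fun n => E.form (u n - w) (u n - w)) atTop (𝓝 0)) (p q : V) :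
    Tendsto (fun n => ((u n : V → ℝ) p - (w : V → ℝ) p) - ((u n : V → ℝ) q - (w : V → ℝ) q))
      atTop (𝓝 0) := by
  have h1 : Tendsto (fun n => √(E.resistance p q * E.form (u n - w) (u n - w))) atTop (𝓝 0) := by
    have := (h.const_mul (E.resistance p q)).sqrt
    simpa using this
  refine squeeze_zero_norm (fun n => ?_) h1
  rw [Real.norm_eq_abs]
  exact Real.abs_le_sqrt (E.sq_sub_le (u n - w) p q)

theorem bddBelow_trace (U : Set V) (f : V → ℝ) :
    BddBelow {r : ℝ | ∃ g : E.dom, (∀ p ∈ U, (g : V → ℝ) p = f p) ∧ r = E.form g g} :=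
  ⟨0, by rintro r ⟨g, -, rfl⟩; exact E.nonneg g⟩

/-- Energy minimizers with prescribed values on a nonempty set exist. -/
theorem exists_isEnergyMinimizer {U : Set V} (hU : U.Nonempty) (f : E.dom) :
    ∃ h : E.dom, (∀ p ∈ U, (h : V → ℝ) p = (f : V → ℝ) p) ∧ E.IsEnergyMinimizer U h := by
  set S := {r : ℝ | ∃ g : E.dom, (∀ p ∈ U, (g : V → ℝ) p = (f : V → ℝ) p) ∧ r = E.form g g}
  have hS : BddBelow S := E.bddBelow_trace U f
  have hSn : S.Nonempty := ⟨_, f, fun _ _ => rfl, rfl⟩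
  have hex : ∀ n : ℕ, ∃ g : E.dom, (∀ p ∈ U, (g : V → ℝ) p = (f : V → ℝ) p) ∧
      E.form g g < sInf S + 1 / ((n : ℝ) + 1) := by
    intro n
    obtain ⟨r, ⟨g, hg, rfl⟩, hr⟩ :=
      exists_lt_of_csInf_lt hSn (lt_add_of_pos_right (sInf S) (Nat.one_div_pos_of_nat (n := n)))
    exact ⟨g, hg, hr⟩
  choose g hgU hg using hex
  have hlim : Tendsto (fun n : ℕ => 1 / ((n : ℝ) + 1)) atTop (𝓝 0) :=
    tendsto_one_div_add_atTop_nhds_zero_nat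
  -- Parallelogram identity: the midpoint of two competitors is a competitor, so its energy is at
  -- least the infimum.
  have hcauchy : ∀ m n, E.form (g m - g n) (g m - g n)
      ≤ 2 * (1 / ((m : ℝ) + 1)) + 2 * (1 / ((n : ℝ) + 1)) := by
    intro m n
    have hmid : sInf S ≤ E.form ((1 / 2 : ℝ) • (g m + g n)) ((1 / 2 : ℝ) • (g m + g n)) := by
      refine csInf_le hS ⟨_, fun p hp => ?_, rfl⟩
      simp only [Submodule.coe_smul, Submodule.coe_add, Pi.smul_apply, Pi.add_apply,
        hgU _ p hp, smul_eq_mul]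
      ring
    simp only [map_smul, LinearMap.smul_apply, smul_eq_mul, form_add_self] at hmid
    rw [form_sub_self]
    linarith [hg m, hg n]
  obtain ⟨w, hw⟩ := E.complete g (by
    intro ε hε
    obtain ⟨N, hN⟩ := (hlim.eventually
      (gt_mem_nhds (show 0 < ε / 4 by positivity))).exists_forall_of_atTop
    refine ⟨N, fun m hm n hn => (hcauchy m n).trans_lt ?_⟩
    linarith [hN m hm, hN n hn])
  obtain ⟨p₀, hp₀⟩ := hU
  set c := (f : V → ℝ) p₀ - (w : V → ℝ) p₀
  have hgw : Tendsto (fun n => E.form (g n - (w + E.const c)) (g n - (w + E.const c)))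
      atTop (𝓝 0) := by
    refine hw.congr fun n => ?_
    rw [← sub_sub, form_sub_const]
  have hval : ∀ p ∈ U, ((w + E.const c : E.dom) : V → ℝ) p = (f : V → ℝ) p := by
    intro p hp
    have h1 := E.tendsto_sub_sub hw p p₀
    simp only [hgU _ p hp, hgU _ p₀ hp₀] at h1
    have h2 := tendsto_nhds_unique h1 tendsto_const_nhds
    simp only [Submodule.coe_add, Pi.add_apply, const_apply, c]
    linarith
  refine ⟨w + E.const c, hval, fun v hv => ?_⟩
  have h1 := E.tendsto_form_left hgw (w + E.const c)
  have h2 : E.form (w + E.const c) (w + E.const c) ≤ sInf S := by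
    -- Lower semicontinuity of the energy, from `2 𝓔(g, w') - 𝓔(w', w') ≤ 𝓔(g, g)` with `w' = w +
    -- c`.
    have h3 : Tendsto (fun n => 2 * E.form (g n) (w + E.const c)
        - E.form (w + E.const c) (w + E.const c) - 1 / ((n : ℝ) + 1)) atTop
        (𝓝 (2 * E.form (w + E.const c) (w + E.const c)
          - E.form (w + E.const c) (w + E.const c) - 0)) :=
      ((h1.const_mul 2).sub_const _).sub hlim
    have h4 := le_of_tendsto' h3 (b := sInf S) (fun n => by
      have := E.nonneg (g n - (w + E.const c))
      rw [form_sub_self] at this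
      linarith [hg n])
    linarith
  exact h2.trans (csInf_le hS ⟨v, fun p hp => (hv p hp).trans (hval p hp), rfl⟩)

variable {E}

theorem IsEnergyMinimizer.trace_eq {U : Set V} {h : E.dom} (hh : E.IsEnergyMinimizer U h)
    {f : V → ℝ} (hf : ∀ p ∈ U, (h : V → ℝ) p = f p) : E.trace U f = E.form h h := by
  apply le_antisymm
  · exact csInf_le (E.bddBelow_trace U f) ⟨h, hf, rfl⟩
  · refine le_csInf ⟨_, h, hf, rfl⟩ ?_
    rintro r ⟨g, hg, rfl⟩
    exact hh g fun p hp => (hg p hp).trans (hf p hp).symm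

/-- An energy minimizer is orthogonal to the functions that vanish on the boundary. -/
theorem IsEnergyMinimizer.form_eq_zero {U : Set V} {h : E.dom} (hh : E.IsEnergyMinimizer U h)
    {v : E.dom} (hv : ∀ p ∈ U, (v : V → ℝ) p = 0) : E.form h v = 0 := by
  -- First variation: the energy gained in passing from `h` to `h + t v` is a nonnegative quadratic
  -- in `t` without constant term, so its linear coefficient vanishes.
  have key : ∀ t : ℝ, 0 ≤ E.form v v * (t * t) + (2 * E.form h v) * t + 0 := by
    intro t
    have := hh (h + t • v) fun p hp => by simp [hv p hp]
    rw [form_add_self] at this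
    simp only [map_smul, LinearMap.smul_apply, smul_eq_mul] at this
    linarith
  have := discrim_le_zero key
  rw [discrim] at this
  nlinarith

theorem isEnergyMinimizer_of_form_eq_zero {U : Set V} {h : E.dom}
    (hh : ∀ v : E.dom, (∀ p ∈ U, (v : V → ℝ) p = 0) → E.form h v = 0) :
    E.IsEnergyMinimizer U h := by
  intro g hg
  have h1 := hh (g - h) fun p hp => by simp [hg p hp]
  have h2 := E.nonneg (g - h)
  rw [map_sub] at h1
  rw [form_sub_self, E.symm g h] at h2
  linarith

theorem IsEnergyMinimizer.add {U : Set V} {h k : E.dom} (hh : E.IsEnergyMinimizer U h)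
    (hk : E.IsEnergyMinimizer U k) : E.IsEnergyMinimizer U (h + k) :=
  isEnergyMinimizer_of_form_eq_zero fun v hv => by
    simp [hh.form_eq_zero hv, hk.form_eq_zero hv]

theorem IsEnergyMinimizer.sub {U : Set V} {h k : E.dom} (hh : E.IsEnergyMinimizer U h)
    (hk : E.IsEnergyMinimizer U k) : E.IsEnergyMinimizer U (h - k) :=
  isEnergyMinimizer_of_form_eq_zero fun v hv => by
    simp [hh.form_eq_zero hv, hk.form_eq_zero hv]

/-- Pythagoras: the energy of a competitor splits. -/
theorem IsEnergyMinimizer.form_sub_eq {U : Set V} {h : E.dom} (hh : E.IsEnergyMinimizer U h)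
    {g : E.dom} (hg : ∀ p ∈ U, (g : V → ℝ) p = (h : V → ℝ) p) :
    E.form (g - h) (g - h) = E.form g g - E.form h h := by
  have h1 := hh.form_eq_zero (v := g - h) fun p hp => by simp [hg p hp]
  rw [map_sub] at h1
  rw [form_sub_self, E.symm g h]
  linarith

theorem eq_of_form_sub_eq_zero {g h : E.dom} (h0 : E.form (g - h) (g - h) = 0) {p₀ : V}
    (hp₀ : (g : V → ℝ) p₀ = (h : V → ℝ) p₀) : g = h := by
  obtain ⟨c, hc⟩ := (E.eq_zero_iff _).1 h0
  have hc0 := hc p₀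
  ext p
  have := hc p
  simp only [Submodule.coe_sub, Pi.sub_apply] at hc0 this
  linarith

/-- By Pythagoras, a competitor of no larger energy differs from the minimizer by a constant, which
is zero since the two agree on the nonempty set `U`. -/
theorem IsEnergyMinimizer.eq_of_form_le {U : Set V} (hU : U.Nonempty) {h g : E.dom}
    (hh : E.IsEnergyMinimizer U h) (hg : ∀ p ∈ U, (g : V → ℝ) p = (h : V → ℝ) p)
    (hle : E.form g g ≤ E.form h h) : g = h := by
  obtain ⟨p₀, hp₀⟩ := hU
  refine eq_of_form_sub_eq_zero (le_antisymm ?_ (E.nonneg _)) (hg p₀ hp₀)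
  rw [hh.form_sub_eq hg]
  linarith

/-- The maximum principle. -/
theorem IsEnergyMinimizer.abs_le {U : Set V} (hU : U.Nonempty) {h : E.dom}
    (hh : E.IsEnergyMinimizer U h) {M : ℝ} (hM : 0 < M) (hb : ∀ p ∈ U, |(h : V → ℝ) p| ≤ M)
    (p : V) : |(h : V → ℝ) p| ≤ M := by
  obtain ⟨v, hv, hle⟩ := E.exists_truncation h (show -M < M by linarith)
  have : v = h := hh.eq_of_form_le hU (fun p hp => by
    have := _root_.abs_le.1 (hb p hp)
    rw [hv, min_eq_right this.2, max_eq_right this.1]) hle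
  rw [← this, hv, _root_.abs_le]
  exact ⟨le_max_left _ _, max_le (by linarith) (min_le_left _ _)⟩

/-- Energy minimizers with the values of `u` on sets exhausting `V` converge to `u`. -/
theorem tendsto_form_sub_minimizer {U : ℕ → Set V} (hmono : Monotone U) (hU0 : (U 0).Nonempty)
    (hU : ∀ p, ∃ n, p ∈ U n) {u : E.dom} {h : ℕ → E.dom}
    (hh : ∀ n, E.IsEnergyMinimizer (U n) (h n))
    (hu : ∀ n, ∀ p ∈ U n, (h n : V → ℝ) p = (u : V → ℝ) p) :
    Tendsto (fun n => E.form (u - h n) (u - h n)) atTop (𝓝 0) := by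
  have hval : ∀ {m n}, n ≤ m → ∀ p ∈ U n, (h m : V → ℝ) p = (h n : V → ℝ) p :=
    fun hnm p hp => (hu _ p (hmono hnm hp)).trans (hu _ p hp).symm
  -- The energies of the minimizers increase and are bounded by that of `u`. By Pythagoras their
  -- increments are the energies of the differences, so the sequence is Cauchy in energy.
  have hinc : Monotone fun n => E.form (h n) (h n) := fun n m hnm => hh n _ (hval hnm)
  have hbdd : BddAbove (range fun n => E.form (h n) (h n)) := by
    refine ⟨E.form u u, ?_⟩
    rintro _ ⟨n, rfl⟩
    exact hh n u fun p hp => (hu n p hp).symm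
  have hconv := tendsto_atTop_ciSup hinc hbdd
  have hcs := Metric.cauchySeq_iff.1 hconv.cauchySeq
  obtain ⟨w, hw⟩ := E.complete h (by
    intro ε hε
    obtain ⟨N, hN⟩ := hcs ε hε
    refine ⟨N, fun m hm n hn => lt_of_le_of_lt ?_ (hN m hm n hn)⟩
    rw [Real.dist_eq]
    rcases le_total n m with hnm | hnm
    · rw [(hh n).form_sub_eq (hval hnm)]; exact le_abs_self _
    · rw [form_sub_comm, (hh m).form_sub_eq (hval hnm), abs_sub_comm]; exact le_abs_self _)
  have hwu : E.form (u - w) (u - w) = 0 := by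
    obtain ⟨q, hq⟩ := hU0
    rw [E.eq_zero_iff]
    refine ⟨(u : V → ℝ) q - (w : V → ℝ) q, fun p => ?_⟩
    obtain ⟨k, hk⟩ := hU p
    have h1 := E.tendsto_sub_sub hw p q
    have h2 : Tendsto (fun n => ((h n : V → ℝ) p - (w : V → ℝ) p)
        - ((h n : V → ℝ) q - (w : V → ℝ) q)) atTop
        (𝓝 (((u : V → ℝ) p - (w : V → ℝ) p) - ((u : V → ℝ) q - (w : V → ℝ) q))) := by
      refine tendsto_const_nhds.congr' ?_
      filter_upwards [eventually_ge_atTop k] with n hn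
      rw [hu n p (hmono hn hk), hu n q (hmono (Nat.zero_le n) hq)]
    have := tendsto_nhds_unique h1 h2
    simp only [Submodule.coe_sub, Pi.sub_apply]
    linarith
  refine squeeze_zero (fun _ => E.nonneg _) (fun n => ?_)
    ((hw.const_mul 2).trans (by rw [mul_zero]))
  have := E.form_sub_self_le u w (h n)
  rw [hwu, E.form_sub_comm w] at this
  linarith

/-- If the truncation `v` of `u` agrees with `u` on `U`, it is as close to `u` as the energy
minimizer with the values of `u` on `U`. -/
theorem IsEnergyMinimizer.form_sub_le {U : Set V} {u v h : E.dom}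
    (hh : E.IsEnergyMinimizer U h) (hu : ∀ p ∈ U, (u : V → ℝ) p = (h : V → ℝ) p)
    (hv : ∀ p ∈ U, (v : V → ℝ) p = (h : V → ℝ) p) (hle : E.form v v ≤ E.form u u) :
    E.form (u - v) (u - v) ≤ 4 * E.form (u - h) (u - h) := by
  have h1 := E.form_sub_self_le u h v
  rw [E.form_sub_comm h v] at h1
  -- The squared distances of `u` and `v` to `h` are their energy excesses over `h`, and that of `v`
  -- is the smaller one; hence the factor `2 + 2`.
  have h2 := hh.form_sub_eq hu
  have h3 := hh.form_sub_eq hv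
  linarith

/-! ### Extension to the completion -/

theorem denseRange_toOmega : DenseRange E.toOmega :=
  UniformSpace.Completion.denseRange_coe (α := E.Space)

theorem dist_toOmega (p q : V) : dist (E.toOmega p) (E.toOmega q) = E.resistance p q :=
  UniformSpace.Completion.dist_eq (α := E.Space) p q

theorem ext_unique (u : E.dom) {φ : E.Omega → ℝ} (hφ : Continuous φ)
    (h : ∀ p, φ (E.toOmega p) = (u : V → ℝ) p) : φ = E.ext u :=
  denseRange_toOmega.equalizer hφ (E.continuous_ext u) (funext fun p => by
    simp [h p, E.ext_toOmega])

theorem ext_add (u v : E.dom) (a : E.Omega) : E.ext (u + v) a = E.ext u a + E.ext v a :=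
  (congrFun (ext_unique (u + v) ((E.continuous_ext u).add (E.continuous_ext v))
    fun p => by simp [ext_toOmega]) a).symm

theorem ext_sub (u v : E.dom) (a : E.Omega) : E.ext (u - v) a = E.ext u a - E.ext v a :=
  (congrFun (ext_unique (u - v) ((E.continuous_ext u).sub (E.continuous_ext v))
    fun p => by simp [ext_toOmega]) a).symm

theorem ext_smul (c : ℝ) (u : E.dom) (a : E.Omega) : E.ext (c • u) a = c * E.ext u a :=
  (congrFun (ext_unique (c • u) ((E.continuous_ext u).const_mul c)
    fun p => by simp [ext_toOmega]) a).symm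

theorem ext_const (c : ℝ) (a : E.Omega) : E.ext (E.const c) a = c :=
  (congrFun (ext_unique (E.const c) (continuous_const (y := c)) fun p => by simp) a).symm

theorem ext_comp {u v : E.dom} {φ : ℝ → ℝ} (hφ : Continuous φ)
    (h : ∀ p, (v : V → ℝ) p = φ ((u : V → ℝ) p)) (a : E.Omega) : E.ext v a = φ (E.ext u a) :=
  (congrFun (ext_unique v (hφ.comp (E.continuous_ext u))
    fun p => by simp [ext_toOmega, h]) a).symm

theorem ext_injective {u v : E.dom} (h : E.ext u = E.ext v) : u = v := by
  ext p
  rw [← E.ext_toOmega, h, E.ext_toOmega]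

/-- The resistance estimate is a closed condition on pairs of points, so it passes from the dense
set of vertices to `Ω`. It turns energy convergence into pointwise control there. -/
theorem ext_sq_sub_le (u : E.dom) (a b : E.Omega) :
    (E.ext u a - E.ext u b) ^ 2 ≤ dist a b * E.form u u := by
  have hu := E.continuous_ext u
  refine denseRange_toOmega.induction_on₂ (p := fun a b =>
    (E.ext u a - E.ext u b) ^ 2 ≤ dist a b * E.form u u) ?_ (fun p q => ?_) a b
  · exact isClosed_le (by fun_prop) (by fun_prop)
  · rw [ext_toOmega, ext_toOmega, dist_toOmega]
    exact E.sq_sub_le u p q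

/-- The functions in the domain separate the points of the completion. -/
theorem exists_ext_ne {a b : E.Omega} (hab : a ≠ b) : ∃ u : E.dom, E.ext u a ≠ E.ext u b := by
  by_contra! h
  -- If no function separates `a` and `b`, then `u p - u q = (u p - ũ a) - (u q - ũ b)`, which
  -- bounds the resistance between `p` and `q`. By density the bound holds on `Ω`, and at `(a, b)`
  -- it reads `dist a b ≤ 0`.
  have key : ∀ x y : E.Omega, dist x y ≤ (√(dist x a) + √(dist y b)) ^ 2 := by
    intro x y
    refine denseRange_toOmega.induction_on₂ (p := fun x y : E.Omega =>
      dist x y ≤ (√(dist x a) + √(dist y b)) ^ 2) ?_ (fun p q => ?_) x y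
    · exact isClosed_le (by fun_prop) (by fun_prop)
    · rw [dist_toOmega]
      refine Real.sSup_le ?_ (sq_nonneg _)
      rintro _ ⟨u, hu, rfl⟩
      rw [div_le_iff₀ hu]
      have h1 := Real.abs_le_sqrt (ext_sq_sub_le u (E.toOmega p) a)
      have h2 := Real.abs_le_sqrt (ext_sq_sub_le u (E.toOmega q) b)
      rw [Real.sqrt_mul dist_nonneg, ext_toOmega] at h1 h2
      have h3 : |(u : V → ℝ) p - (u : V → ℝ) q|
          ≤ (√(dist (E.toOmega p) a) + √(dist (E.toOmega q) b)) * √(E.form u u) := by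
        have e : (u : V → ℝ) p - (u : V → ℝ) q
            = ((u : V → ℝ) p - E.ext u a) - ((u : V → ℝ) q - E.ext u b) := by
          rw [h u]; ring
        rw [e, add_mul]
        exact (abs_sub _ _).trans (add_le_add h1 h2)
      calc _ = |(u : V → ℝ) p - (u : V → ℝ) q| ^ 2 := (sq_abs _).symm
        _ ≤ ((√(dist (E.toOmega p) a) + √(dist (E.toOmega q) b)) * √(E.form u u)) ^ 2 := by gcongr
        _ = _ := by rw [mul_pow, Real.sq_sqrt hu.le]
  have := key a b
  simp only [dist_self, Real.sqrt_zero, add_zero] at this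
  exact hab (dist_le_zero.1 (by simpa using this))

end ResistanceForm

/-! ### Geometry of the cells -/

namespace FinitelyRamifiedCellStructure

variable {F : Type*} [MetricSpace F] {A : Type*} (C : FinitelyRamifiedCellStructure F A)

/-- A connected set with two points is infinite. Distinct cells of one level meet in finite sets, so
this is what makes the cells a tree. -/
theorem infinite_cell (α : A) : (C.cell α).Infinite :=
  (C.isConnected_cell α).isPreconnected.infinite_of_nontrivial
    ((C.nontrivial_vert α).mono (C.vert_subset α))

theorem iUnion_cell_level (n : ℕ) (x : F) : ∃ α ∈ C.level n, x ∈ C.cell α := by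
  induction n with
  | zero => exact ⟨C.root, by simp [C.level_zero], by simp [C.cell_root]⟩
  | succ n ih =>
    obtain ⟨α, hα, hx⟩ := ih
    obtain ⟨s, hs, he⟩ := C.cell_eq_iUnion n α hα
    rw [he, mem_iUnion₂] at hx
    obtain ⟨β, hβ, hx⟩ := hx
    exact ⟨β, hs hβ, hx⟩

variable {C}

theorem eq_of_subset_of_subset {n : ℕ} {α α' β : A} (hα : α ∈ C.level n) (hα' : α' ∈ C.level n)
    (h : C.cell β ⊆ C.cell α) (h' : C.cell β ⊆ C.cell α') : α = α' := by
  by_contra hne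
  refine C.infinite_cell β (((C.finite_vert α).inter_of_left (C.vert α')).subset ?_)
  rw [← C.cell_inter n α hα α' hα' hne]
  exact subset_inter h h'

/-- Otherwise each point of the cell also lies in another cell of the same level, hence belongs to
the finite vertex boundary, while cells are infinite. -/
theorem exists_parent {n : ℕ} {β : A} (hβ : β ∈ C.level (n + 1)) :
    ∃ α ∈ C.level n, C.cell β ⊆ C.cell α := by
  by_contra! hcon
  refine C.infinite_cell β ((C.finite_vert β).subset fun x hx => ?_)
  obtain ⟨α, hα, hxα⟩ := C.iUnion_cell_level n x
  obtain ⟨s, hs, he⟩ := C.cell_eq_iUnion n α hα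
  rw [he, mem_iUnion₂] at hxα
  obtain ⟨γ, hγ, hxγ⟩ := hxα
  have hne : β ≠ γ := by
    rintro rfl
    exact hcon α hα (he ▸ subset_biUnion_of_mem (u := fun β => C.cell β) hγ)
  exact ((C.cell_inter _ β hβ γ (hs hγ) hne).subset ⟨hx, hxγ⟩).1

theorem exists_ancestor {m n : ℕ} (hnm : n ≤ m) {β : A} (hβ : β ∈ C.level m) :
    ∃ α ∈ C.level n, C.cell β ⊆ C.cell α := by
  induction m, hnm using Nat.le_induction generalizing β with
  | base => exact ⟨β, hβ, Subset.rfl⟩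
  | succ m _ ih =>
    obtain ⟨γ, hγ, h1⟩ := exists_parent hβ
    obtain ⟨α, hα, h2⟩ := ih hγ
    exact ⟨α, hα, h1.trans h2⟩

/-- The ancestors of a cell are nested. -/
theorem exists_between {l m n : ℕ} (hlm : l ≤ m) (hmn : m ≤ n) {α β : A} (hα : α ∈ C.level l)
    (hβ : β ∈ C.level n) (h : C.cell β ⊆ C.cell α) :
    ∃ γ ∈ C.level m, C.cell β ⊆ C.cell γ ∧ C.cell γ ⊆ C.cell α := by
  obtain ⟨γ, hγ, h1⟩ := exists_ancestor hmn hβ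
  obtain ⟨δ, hδ, h2⟩ := exists_ancestor hlm hγ
  obtain rfl := eq_of_subset_of_subset hα hδ h (h1.trans h2)
  exact ⟨γ, hγ, h1, h2⟩

theorem exists_subcell {m n : ℕ} (hnm : n ≤ m) {α : A} (hα : α ∈ C.level n) {x : F}
    (hx : x ∈ C.cell α) : ∃ β ∈ C.level m, C.cell β ⊆ C.cell α ∧ x ∈ C.cell β := by
  induction m, hnm using Nat.le_induction with
  | base => exact ⟨α, hα, Subset.rfl, hx⟩
  | succ m _ ih =>
    obtain ⟨β, hβ, h1, h2⟩ := ih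
    obtain ⟨s, hs, he⟩ := C.cell_eq_iUnion m β hβ
    have h2' := h2
    rw [he, mem_iUnion₂] at h2'
    obtain ⟨γ, hγ, hxγ⟩ := h2'
    exact ⟨γ, hs hγ, (he ▸ subset_biUnion_of_mem (u := fun β => C.cell β) hγ).trans h1, hxγ⟩

theorem ssubset_of_subset {n : ℕ} {α β : A} (hα : α ∈ C.level n) (hβ : β ∈ C.level (n + 1))
    (h : C.cell β ⊆ C.cell α) : C.cell β ⊂ C.cell α := by
  refine h.ssubset_of_ne fun he => ?_
  obtain rfl := C.cell_injective he
  exact Finset.disjoint_left.1 (C.level_disjoint n (n + 1) (by simp)) hα hβ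

variable (C)

/-- König's lemma: if large cells existed at every level, a strictly decreasing sequence of large
cells could be chosen, contradicting its shrinking to a point. -/
theorem not_forall_exists_large_cell {ε : ℝ} (hε : 0 < ε) :
    ¬ ∀ m, ∃ β ∈ C.level m, ∃ x ∈ C.cell β, ∃ y ∈ C.cell β, ε ≤ dist x y := by
  intro hall
  let Big : A → Prop := fun β => ∃ x ∈ C.cell β, ∃ y ∈ C.cell β, ε ≤ dist x y
  have Big.mono : ∀ {β γ}, C.cell β ⊆ C.cell γ → Big β → Big γ := by
    rintro β γ h ⟨x, hx, y, hy, hxy⟩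
    exact ⟨x, h hx, y, h hy, hxy⟩
  -- The property to propagate along a branch: the cell has large descendants at all later levels.
  let P : ℕ → A → Prop := fun n α => α ∈ C.level n ∧
    ∀ m ≥ n, ∃ β ∈ C.level m, C.cell β ⊆ C.cell α ∧ Big β
  have h0 : P 0 C.root := by
    refine ⟨by simp [C.level_zero], fun m _ => ?_⟩
    obtain ⟨β, hβ, h⟩ := hall m
    exact ⟨β, hβ, by simp [C.cell_root], h⟩
  have hstep : ∀ n α, P n α → ∃ γ, P (n + 1) γ ∧ C.cell γ ⊂ C.cell α := by
    rintro n α ⟨hα, hP⟩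
    by_contra! hcon
    have hbad : ∀ γ ∈ C.level (n + 1), C.cell γ ⊆ C.cell α →
        ∃ m ≥ n + 1, ∀ β ∈ C.level m, C.cell β ⊆ C.cell γ → ¬ Big β := by
      intro γ hγ hγα
      by_contra! h
      exact hcon γ ⟨hγ, h⟩ (ssubset_of_subset hα hγ hγα)
    choose! m hm hbad using hbad
    -- `M` lies beyond the finitely many levels at which the children run out of large descendants.
    -- A large descendant at level `M` lies in some child `γ`, and its ancestor at level `m γ` is
    -- large too.
    set M := max (n + 1) ((C.level (n + 1)).sup m)
    obtain ⟨β, hβ, hβα, hbig⟩ := hP M ((Nat.le_succ n).trans (le_max_left _ _))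
    obtain ⟨γ, hγ, hβγ, hγα⟩ := exists_between (Nat.le_succ n) (le_max_left _ _) hα hβ hβα
    obtain ⟨δ, hδ, hβδ, hδγ⟩ := exists_between (hm γ hγ hγα)
      ((Finset.le_sup hγ).trans (le_max_right _ _)) hγ hβ hβγ
    exact hbad γ hγ hγα δ hδ hδγ (Big.mono hβδ hbig)
  choose! next hnext hsub using hstep
  let a : ℕ → A := fun n => Nat.rec C.root (fun n α => next n α) n
  have ha : ∀ n, P n (a n) := by
    intro n
    induction n with
    | zero => exact h0
    | succ n ih => exact hnext n _ ih
  have hanti : StrictAnti fun n => C.cell (a n) := strictAnti_nat_of_succ_lt fun n =>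
    hsub n _ (ha n)
  obtain ⟨z, hz⟩ := C.iInter_cell a hanti
  obtain ⟨n, hn⟩ := exists_subset_nhds_of_isCompact (V := fun n => C.cell (a n))
    hanti.antitone.directed_ge (fun n => C.isCompact_cell _) (U := Metric.ball z (ε / 2))
    (fun x hx => by
      rw [hz, mem_singleton_iff] at hx
      rw [hx]
      exact Metric.ball_mem_nhds _ (by positivity))
  obtain ⟨β, -, hβ, x, hx, y, hy, hxy⟩ := (ha n).2 n le_rfl
  have h1 := hn (hβ hx)
  have h2 := hn (hβ hy)
  rw [Metric.mem_ball] at h1 h2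
  linarith [dist_triangle_right x y z]

/-- The diameters of the `n`-cells tend to zero. -/
theorem exists_level_dist_lt {ε : ℝ} (hε : 0 < ε) :
    ∃ n, ∀ m ≥ n, ∀ β ∈ C.level m, ∀ x ∈ C.cell β, ∀ y ∈ C.cell β, dist x y < ε := by
  have := C.not_forall_exists_large_cell hε
  push Not at this
  obtain ⟨n, hn⟩ := this
  refine ⟨n, fun m hm β hβ x hx y hy => ?_⟩
  obtain ⟨α, hα, h⟩ := exists_ancestor hm hβ
  exact hn α hα x (h hx) y (h hy)

theorem verticesAt_zero_nonempty : (C.verticesAt 0).Nonempty := by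
  obtain ⟨p, hp⟩ := (C.nontrivial_vert C.root).nonempty
  exact ⟨⟨p, mem_iUnion.2 ⟨_, hp⟩⟩, C.root, by simp [C.level_zero], hp⟩

theorem verticesAt_mono : Monotone C.verticesAt := by
  refine monotone_nat_of_le_succ fun n p hp => ?_
  obtain ⟨α, hα, hp⟩ := hp
  obtain ⟨s, hs, he⟩ := C.cell_eq_iUnion n α hα
  have := C.vert_subset_of_cell_eq α s he hp
  rw [mem_iUnion₂] at this
  obtain ⟨β, hβ, h⟩ := this
  exact ⟨β, hs hβ, h⟩

theorem verticesAt_nonempty (n : ℕ) : (C.verticesAt n).Nonempty :=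
  C.verticesAt_zero_nonempty.mono (C.verticesAt_mono (Nat.zero_le n))

theorem exists_mem_verticesAt (p : C.vertices) : ∃ n, p ∈ C.verticesAt n := by
  obtain ⟨α, hα⟩ := mem_iUnion.1 p.2
  obtain ⟨n, hn⟩ := C.exists_level α
  exact ⟨n, α, hn, hα⟩

theorem finite_verticesAt (n : ℕ) : (C.verticesAt n).Finite := by
  have h : (⋃ α ∈ C.level n, C.vert α).Finite :=
    (C.level n).finite_toSet.biUnion fun α _ => C.finite_vert α
  refine (h.preimage (f := ((↑) : C.vertices → F)) Subtype.val_injective.injOn).subset ?_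
  rintro p ⟨α, hα, hp⟩
  exact mem_iUnion₂.2 ⟨α, hα, hp⟩

theorem countable_vertices : Countable C.vertices := by
  have := C.countable_index
  exact (countable_iUnion fun α => (C.finite_vert α).countable).to_subtype

variable {C}

theorem mem_vert_of_mem_cell {n : ℕ} {α : A} (hα : α ∈ C.level n) {p : C.vertices}
    (hp : p ∈ C.verticesAt n) (hpα : (p : F) ∈ C.cell α) : (p : F) ∈ C.vert α := by
  obtain ⟨β, hβ, h⟩ := hp
  by_cases hne : α = β
  · rwa [hne]
  · exact ((C.cell_inter n α hα β hβ hne).subset ⟨hpα, C.vert_subset β h⟩).1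

/-- The vertices contained in a cell are dense in it. -/
theorem mem_closure_vertices {n : ℕ} {α : A} (hα : α ∈ C.level n) {x : F} (hx : x ∈ C.cell α) :
    x ∈ closure (C.vertices ∩ C.cell α) := by
  rw [Metric.mem_closure_iff]
  intro ε hε
  obtain ⟨k, hk⟩ := C.exists_level_dist_lt hε
  obtain ⟨β, hβ, hβα, hxβ⟩ := exists_subcell (le_max_left n k) hα hx
  obtain ⟨p, hp⟩ := (C.nontrivial_vert β).nonempty
  exact ⟨p, ⟨mem_iUnion.2 ⟨β, hp⟩, hβα (C.vert_subset β hp)⟩,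
    hk _ (le_max_right _ _) β hβ x hxβ p (C.vert_subset β hp)⟩

theorem dense_vertices : Dense C.vertices := fun x =>
  closure_mono inter_subset_left (mem_closure_vertices (n := 0) (α := C.root)
    (by simp [C.level_zero]) (by simp [C.cell_root]))

/-! ### Locality of the energy -/

variable {E : ResistanceForm C.vertices}

theorem exists_harmonic (E : ResistanceForm C.vertices) (n : ℕ) (f : C.vertices → ℝ) :
    ∃ h : E.dom, C.IsHarmonic E n h ∧
      ∀ p ∈ C.verticesAt n, (h : C.vertices → ℝ) p = f p := by
  obtain ⟨u, hu⟩ := E.exists_extension (C.finite_verticesAt n).toFinset f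
  obtain ⟨h, hh, hmin⟩ := E.exists_isEnergyMinimizer (C.verticesAt_nonempty n) u
  exact ⟨h, hmin, fun p hp => (hh p hp).trans (hu p (by simpa using hp))⟩

/-- The energy of two functions, one of which is `n`-harmonic, vanishes if on each `n`-cell one
of them vanishes at the boundary. -/
theorem IsHarmonic.form_eq_zero_of_forall_or (hE : C.IsCompatible E) {n : ℕ} {u v : E.dom}
    (hu : C.IsHarmonic E n u)
    (h : ∀ α ∈ C.level n, (∀ p : C.vertices, (p : F) ∈ C.vert α → (u : C.vertices → ℝ) p = 0) ∨
      ∀ p : C.vertices, (p : F) ∈ C.vert α → (v : C.vertices → ℝ) p = 0) :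
    E.form u v = 0 := by
  obtain ⟨Q, hQ⟩ := hE
  obtain ⟨w, hw, hwv⟩ := exists_harmonic E n (v : C.vertices → ℝ)
  have h1 : E.form u v = E.form u w := by
    have := ResistanceForm.IsEnergyMinimizer.form_eq_zero hu (v := v - w)
      fun p hp => by simp [hwv p hp]
    rw [map_sub] at this
    linarith
  have hadd : E.form (u + w) (u + w)
      = ∑ α ∈ C.level n, Q α (C.restrictVert α ((u + w : E.dom) : C.vertices → ℝ)) := by
    rw [← hQ, ResistanceForm.IsEnergyMinimizer.trace_eq (hu.add hw) fun _ _ => rfl]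
  have hsub : E.form (u - w) (u - w)
      = ∑ α ∈ C.level n, Q α (C.restrictVert α ((u - w : E.dom) : C.vertices → ℝ)) := by
    rw [← hQ, ResistanceForm.IsEnergyMinimizer.trace_eq (hu.sub hw) fun _ _ => rfl]
  -- On each boundary `V_α`, `u + w` and `u - w` are opposite if `u` vanishes there and equal if
  -- `v`, hence `w`, does. A quadratic form does not distinguish these cases, so the cross term is
  -- zero.
  have heq : E.form (u + w) (u + w) = E.form (u - w) (u - w) := by
    rw [hadd, hsub]
    refine Finset.sum_congr rfl fun α hα => ?_
    rcases h α hα with h0 | h0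
    · rw [← QuadraticMap.map_neg]
      congr 1
      ext p
      have := h0 ⟨p, mem_iUnion.2 ⟨α, p.2⟩⟩ p.2
      simp [restrictVert, this]
    · congr 1
      ext p
      have := h0 ⟨p, mem_iUnion.2 ⟨α, p.2⟩⟩ p.2
      have h2 := hwv ⟨p, mem_iUnion.2 ⟨α, p.2⟩⟩ ⟨α, hα, p.2⟩
      simp [restrictVert, h2, this]
  rw [ResistanceForm.form_add_self, ResistanceForm.form_sub_self] at heq
  linarith

/-- The energy minimizers with the values of `u` on the sets `V_n` converge to `u`. -/
theorem tendsto_form_sub_harmonic {u : E.dom} {h : ℕ → E.dom} (hh : ∀ n, C.IsHarmonic E n (h n))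
    (hu : ∀ n, ∀ p ∈ C.verticesAt n, (h n : C.vertices → ℝ) p = (u : C.vertices → ℝ) p) :
    Tendsto (fun n => E.form (u - h n) (u - h n)) atTop (𝓝 0) :=
  ResistanceForm.tendsto_form_sub_minimizer C.verticesAt_mono C.verticesAt_zero_nonempty
    C.exists_mem_verticesAt hh hu

/-- The energy of two functions vanishes if on each sufficiently small cell one of them
vanishes. -/
theorem form_eq_zero_of_forall_or (hE : C.IsCompatible E) {n : ℕ} {u v : E.dom}
    (h : ∀ m ≥ n, ∀ α ∈ C.level m,
      (∀ p : C.vertices, (p : F) ∈ C.vert α → (u : C.vertices → ℝ) p = 0) ∨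
      ∀ p : C.vertices, (p : F) ∈ C.vert α → (v : C.vertices → ℝ) p = 0) :
    E.form u v = 0 := by
  choose w hw hwu using fun n => exists_harmonic E n (u : C.vertices → ℝ)
  have hlim := tendsto_form_sub_harmonic hw hwu
  have h1 := E.tendsto_form_left (u := w) (w := u) (by simpa only [E.form_sub_comm u] using hlim) v
  refine tendsto_nhds_unique h1 (tendsto_const_nhds.congr' ?_)
  filter_upwards [eventually_ge_atTop n] with m hm
  refine ((hw m).form_eq_zero_of_forall_or hE fun α hα => ?_).symm
  refine (h m hm α hα).imp_left fun h0 p hp => ?_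
  rw [hwu m p ⟨α, hα, hp⟩, h0 p hp]

/-- A harmonic function that vanishes at the boundary of a cell vanishes in the cell. -/
theorem IsHarmonic.eq_zero_of_mem_cell (hE : C.IsCompatible E) {n : ℕ} {h : E.dom}
    (hh : C.IsHarmonic E n h) {α : A} (hα : α ∈ C.level n)
    (h0 : ∀ p : C.vertices, (p : F) ∈ C.vert α → (h : C.vertices → ℝ) p = 0)
    (p : C.vertices) (hp : (p : F) ∈ C.cell α) : (h : C.vertices → ℝ) p = 0 := by
  classical
  obtain ⟨k, hk⟩ := C.exists_mem_verticesAt p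
  set m := max n k
  have hnm : n ≤ m := le_max_left _ _
  have hpm : p ∈ C.verticesAt m := C.verticesAt_mono (le_max_right _ _) hk
  -- A competitor for `h`: erase `h` inside the cell `α` on `V_m`, where `m` is large enough for `p`
  -- to be in `V_m`, and fill in harmonically.
  obtain ⟨g, hg, hgv⟩ := exists_harmonic E m
    fun q => if (q : F) ∈ C.cell α then 0 else (h : C.vertices → ℝ) q
  have hgh : ∀ q ∈ C.verticesAt n, (g : C.vertices → ℝ) q = (h : C.vertices → ℝ) q := by
    intro q hq
    rw [hgv q (C.verticesAt_mono hnm hq)]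
    split_ifs with hqα
    · exact (h0 q (mem_vert_of_mem_cell hα hq hqα)).symm
    · rfl
  have horth : E.form g (h - g) = 0 := by
    refine hg.form_eq_zero_of_forall_or hE fun β hβ => ?_
    obtain ⟨γ, hγ, hβγ⟩ := exists_ancestor hnm hβ
    by_cases hγα : γ = α
    · left
      intro q hq
      rw [hgv q ⟨β, hβ, hq⟩, if_pos]
      exact hγα ▸ hβγ (C.vert_subset β hq)
    · right
      intro q hq
      simp only [Submodule.coe_sub, Pi.sub_apply]
      rw [hgv q ⟨β, hβ, hq⟩]
      split_ifs with hqα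
      · rw [h0 q, sub_zero]
        exact ((C.cell_inter n γ hγ α hα hγα).subset ⟨hβγ (C.vert_subset β hq), hqα⟩).2
      · simp
  have hle : E.form g g ≤ E.form h h := by
    have := E.nonneg (h - g)
    rw [ResistanceForm.form_sub_self] at this
    rw [map_sub] at horth
    rw [E.symm h g] at this
    linarith
  have := ResistanceForm.IsEnergyMinimizer.eq_of_form_le (C.verticesAt_nonempty n) hh hgh hle
  rw [← this, hgv p hpm, if_pos hp]

/-- A harmonic function that is constant at the boundary of a cell is constant in the cell. -/
theorem IsHarmonic.eq_const_of_mem_cell (hE : C.IsCompatible E) {n : ℕ} {h : E.dom}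
    (hh : C.IsHarmonic E n h) {α : A} (hα : α ∈ C.level n) {c : ℝ}
    (h0 : ∀ p : C.vertices, (p : F) ∈ C.vert α → (h : C.vertices → ℝ) p = c)
    (p : C.vertices) (hp : (p : F) ∈ C.cell α) : (h : C.vertices → ℝ) p = c := by
  have hc : C.IsHarmonic E n (E.const c) :=
    ResistanceForm.isEnergyMinimizer_of_form_eq_zero fun v _ => E.form_const_left c v
  have hk : C.IsHarmonic E n (h - E.const c) := ResistanceForm.IsEnergyMinimizer.sub hh hc
  have := hk.eq_zero_of_mem_cell hE hα (fun q hq => by simp [h0 q hq]) p hp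
  simp only [Submodule.coe_sub, Pi.sub_apply, ResistanceForm.const_apply] at this
  linarith

/-- The continuous extensions of harmonic functions separate the points of `F`. -/
theorem exists_harmonic_ne (hE : C.IsCompatible E)
    (hcont : ∀ (n : ℕ) (u : E.dom), C.IsHarmonic E n u →
      ∃ φ : C(F, ℝ), ∀ p : C.vertices, φ p = (u : C.vertices → ℝ) p) {x y : F} (hxy : x ≠ y) :
    ∃ (u : E.dom) (φ : C(F, ℝ)), (∀ p : C.vertices, φ p = (u : C.vertices → ℝ) p) ∧
      φ x ≠ φ y := by
  classical
  -- Cells of diameter below half the distance that contain `x` and `y` cannot share a vertex. The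
  -- harmonic function with boundary values the indicator of `V_α` is then `1` on the first cell and
  -- `0` on the second.
  have hd : 0 < dist x y / 2 := by have := dist_pos.2 hxy; positivity
  obtain ⟨n, hn⟩ := C.exists_level_dist_lt hd
  replace hn := hn n le_rfl
  obtain ⟨α, hα, hxα⟩ := C.iUnion_cell_level n x
  obtain ⟨β, hβ, hyβ⟩ := C.iUnion_cell_level n y
  obtain ⟨h, hh, hval⟩ := exists_harmonic E n fun p => if (p : F) ∈ C.vert α then 1 else 0
  obtain ⟨φ, hφ⟩ := hcont n h hh
  have key : ∀ γ ∈ C.level n, ∀ c : ℝ, (∀ p : C.vertices, (p : F) ∈ C.vert γ →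
      (h : C.vertices → ℝ) p = c) → ∀ z ∈ C.cell γ, φ z = c := by
    intro γ hγ c hc z hz
    have hcl : IsClosed {z | φ z = c} := isClosed_eq φ.continuous continuous_const
    refine hcl.closure_subset_iff.2 ?_ (mem_closure_vertices hγ hz)
    rintro q ⟨hq, hqγ⟩
    exact (hφ ⟨q, hq⟩).trans (hh.eq_const_of_mem_cell hE hγ hc ⟨q, hq⟩ hqγ)
  refine ⟨h, φ, hφ, ?_⟩
  rw [key α hα 1 (fun p hp => by rw [hval p ⟨α, hα, hp⟩, if_pos hp]) x hxα,
    key β hβ 0 (fun p hp => ?_) y hyβ]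
  · exact one_ne_zero
  · rw [hval p ⟨β, hβ, hp⟩, if_neg]
    intro hpα
    have h1 := hn α hα x hxα p (C.vert_subset α hpα)
    have h2 := hn β hβ y hyβ p (C.vert_subset β hp)
    linarith [dist_triangle_right x y p]

/-! ### The embedding of the completion -/

/-- The inclusion of the vertices, with the resistance metric, into `F`. -/
def inclusion (E : ResistanceForm C.vertices) : E.Space → F := fun p => (@id C.vertices p : F)

/-- The completion of the vertices in the resistance metric maps continuously and injectively
to `F`. -/
theorem exists_embedding [CompactSpace F] (hE : C.IsCompatible E)
    (hcont : ∀ (n : ℕ) (u : E.dom), C.IsHarmonic E n u →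
      ∃ φ : C(F, ℝ), ∀ p : C.vertices, φ p = (u : C.vertices → ℝ) p) :
    ∃ θ : E.Omega → F, Continuous θ ∧ Function.Injective θ ∧
      ∀ p : C.vertices, θ (E.toOmega p) = p := by
  have di : IsDenseInducing (fun p : E.Space => E.toOmega p) :=
    UniformSpace.Completion.isDenseInducing_coe (α := E.Space)
  have htend : ∀ ω : E.Omega, ∃ x : F,
      Tendsto (inclusion E) (comap (fun p : E.Space => E.toOmega p) (𝓝 ω)) (𝓝 x) := by
    intro ω
    have hne : (comap (fun p : E.Space => E.toOmega p) (𝓝 ω)).NeBot := di.comap_nhds_neBot ω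
    have hval : ∀ (u : E.dom) (φ : C(F, ℝ)),
        (∀ p : C.vertices, φ p = (u : C.vertices → ℝ) p) → ∀ x : F,
        MapClusterPt x (comap (fun p : E.Space => E.toOmega p) (𝓝 ω))
          (inclusion E) → φ x = E.ext u ω := by
      intro u φ hφ x hx
      have h1 : MapClusterPt (φ x) (comap (fun p : E.Space => E.toOmega p) (𝓝 ω))
          (φ ∘ inclusion E) :=
        hx.continuousAt_comp φ.continuous.continuousAt
      have h2 : Tendsto (φ ∘ inclusion E)
          (comap (fun p : E.Space => E.toOmega p) (𝓝 ω)) (𝓝 (E.ext u ω)) := by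
        have : (φ ∘ inclusion E) = E.ext u ∘ E.toOmega := by
          funext p
          exact (hφ p).trans (E.ext_toOmega u p).symm
        rw [this]
        exact ((E.continuous_ext u).tendsto ω).comp tendsto_comap
      exact eq_of_nhds_neBot (h1.neBot.mono (inf_le_inf_left _ h2))
    obtain ⟨x, hx⟩ := exists_clusterPt_of_compactSpace
      (map (inclusion E) (comap (fun p : E.Space => E.toOmega p) (𝓝 ω)))
    refine ⟨x, tendsto_nhds_of_unique_mapClusterPt fun y hy => ?_⟩
    by_contra hne
    obtain ⟨u, φ, hφ, hφne⟩ := exists_harmonic_ne hE hcont hne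
    exact hφne ((hval u φ hφ y hy).trans (hval u φ hφ x hx).symm)
  have hθ := di.continuous_extend htend
  have hθV : ∀ p : C.vertices,
      di.extend (inclusion E) (E.toOmega p) = p := by
    intro p
    obtain ⟨x, hx⟩ := htend (E.toOmega p)
    -- A vertex is itself an admissible approach to its image in `Ω`, so the limit there is the
    -- vertex.
    have hp : pure p ≤ comap (fun p : E.Space => E.toOmega p) (𝓝 (E.toOmega p)) :=
      map_le_iff_le_comap.1 ((Filter.map_pure _ _).trans_le (pure_le_nhds _))
    have hpx : (p : F) = x := by
      have := hx.mono_left hp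
      exact pure_le_nhds_iff.1 this
    rw [hpx]
    exact di.extend_eq_of_tendsto hx
  refine ⟨_, hθ, fun a b hab => ?_, hθV⟩
  by_contra hne
  obtain ⟨u, hu⟩ := ResistanceForm.exists_ext_ne hne
  choose h hh hhu using fun n => exists_harmonic E n (u : C.vertices → ℝ)
  -- Extensions of harmonic functions factor through the map to `F`, so they cannot separate `a`
  -- from `b`; neither can their energy limit `u`.
  have hext : ∀ n, E.ext (h n) a = E.ext (h n) b := by
    intro n
    obtain ⟨φ, hφ⟩ := hcont n _ (hh n)
    rw [← ResistanceForm.ext_unique (h n) (φ.continuous.comp hθ) fun p => by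
      rw [Function.comp_apply, hθV, hφ]]
    simp only [Function.comp_apply, hab]
  have hlim := (tendsto_form_sub_harmonic hh hhu).const_mul (dist a b)
  rw [mul_zero] at hlim
  have hle : (E.ext u a - E.ext u b) ^ 2 ≤ 0 := ge_of_tendsto' hlim fun n => by
    have := ResistanceForm.ext_sq_sub_le (u - h n) a b
    rwa [ResistanceForm.ext_sub, ResistanceForm.ext_sub, hext n, sub_sub_sub_cancel_right] at this
  exact hu (sub_eq_zero.1 (pow_eq_zero_iff two_ne_zero |>.1 (le_antisymm hle (sq_nonneg _))))

end FinitelyRamifiedCellStructure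

/-! ### The realization of a resistance form in an `L²` space -/

/-- A preimage is obtained by extending by zero off the image of `j`, which a measurable embedding
allows. -/
theorem MeasureTheory.Lp.compMeasurePreserving_surjective {X Y : Type*} [MeasurableSpace X]
    [MeasurableSpace Y] {μ : Measure X} {ν : Measure Y} {j : X → Y} (hj : MeasurableEmbedding j)
    (hp : MeasurePreserving j μ ν) :
    Function.Surjective (Lp.compMeasurePreserving (E := ℝ) (p := 2) j hp) := by
  intro f
  have he : Function.extend j f 0 ∘ j = f := funext fun x => hj.injective.extend_apply _ _ _
  have hm : MemLp (Function.extend j f 0) 2 ν := by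
    rw [← hp.map_eq, hj.memLp_map_measure_iff, he]
    exact Lp.memLp f
  refine ⟨hm.toLp _, Lp.ext ?_⟩
  filter_upwards [Lp.coeFn_compMeasurePreserving (hm.toLp _) hp,
    hp.quasiMeasurePreserving.ae_eq_comp hm.coeFn_toLp] with x h1 h2
  rw [h1, h2, he]

namespace ResistanceForm

variable {V : Type*} {E : ResistanceForm V} {X : Type*} [MeasurableSpace X]
  {μ : Measure E.Omega} {ν : Measure X} {j : E.Omega → X}

/-- Continuous functions that agree almost everywhere for a measure of full support agree
everywhere. The well-definedness of the form on `L²` rests on this. -/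
theorem eq_of_ext_ae_eq [μ.IsOpenPosMeasure] {u v : E.dom} (h : E.ext u =ᵐ[μ] E.ext v) : u = v :=
  ext_injective ((Continuous.ae_eq_iff_eq μ (E.continuous_ext u) (E.continuous_ext v)).1 h)

variable (μ j) in
/-- `f ∘ j` is almost everywhere equal to the extension of `u`. -/
def Represents (f : Lp ℝ 2 ν) (u : E.dom) : Prop := (fun x => f (j x)) =ᵐ[μ] E.ext u

theorem Represents.add (hj : MeasurePreserving j μ ν) {f g : Lp ℝ 2 ν} {u v : E.dom}
    (hf : Represents μ j f u) (hg : Represents μ j g v) : Represents μ j (f + g) (u + v) := by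
  filter_upwards [hf, hg, hj.quasiMeasurePreserving.ae_eq_comp (Lp.coeFn_add f g)] with x h1 h2 h3
  simp only [Function.comp_apply, Pi.add_apply] at h3
  rw [h3, ext_add, h1, h2]

theorem Represents.sub (hj : MeasurePreserving j μ ν) {f g : Lp ℝ 2 ν} {u v : E.dom}
    (hf : Represents μ j f u) (hg : Represents μ j g v) : Represents μ j (f - g) (u - v) := by
  filter_upwards [hf, hg, hj.quasiMeasurePreserving.ae_eq_comp (Lp.coeFn_sub f g)] with x h1 h2 h3
  simp only [Function.comp_apply, Pi.sub_apply] at h3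
  rw [h3, ext_sub, h1, h2]

theorem Represents.smul (hj : MeasurePreserving j μ ν) (c : ℝ) {f : Lp ℝ 2 ν} {u : E.dom}
    (hf : Represents μ j f u) : Represents μ j (c • f) (c • u) := by
  filter_upwards [hf, hj.quasiMeasurePreserving.ae_eq_comp (Lp.coeFn_smul c f)] with x h1 h3
  simp only [Function.comp_apply, Pi.smul_apply, smul_eq_mul] at h3
  rw [h3, ext_smul, h1]

theorem represents_zero (hj : MeasurePreserving j μ ν) :
    Represents μ j (0 : Lp ℝ 2 ν) (0 : E.dom) := by
  filter_upwards [hj.quasiMeasurePreserving.ae_eq_comp (Lp.coeFn_zero ℝ 2 ν)] with x h3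
  have h0 := ext_smul (0 : ℝ) (0 : E.dom) x
  rw [zero_smul, zero_mul] at h0
  rw [h0]
  exact h3

theorem Represents.unique [μ.IsOpenPosMeasure] {f : Lp ℝ 2 ν} {u v : E.dom}
    (hu : Represents μ j f u) (hv : Represents μ j f v) : u = v :=
  eq_of_ext_ae_eq (hu.symm.trans hv)

theorem Represents.memLp (hj : MeasurePreserving j μ ν) {f : Lp ℝ 2 ν} {u : E.dom}
    (hf : Represents μ j f u) : MemLp (E.ext u) 2 μ :=
  ((Lp.memLp f).comp_measurePreserving hj).ae_eq hf

theorem Represents.norm_sq (hj : MeasurePreserving j μ ν) {f : Lp ℝ 2 ν} {u : E.dom}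
    (hf : Represents μ j f u) : ‖f‖ ^ 2 = ∫ x, E.ext u x ^ 2 ∂μ := by
  have hm : AEStronglyMeasurable (fun y => f y ^ 2) (μ.map j) := by
    rw [hj.map_eq]
    exact (Lp.aestronglyMeasurable f).pow 2
  rw [← real_inner_self_eq_norm_sq, L2.inner_def]
  simp only [real_inner_self_eq_norm_sq, Real.norm_eq_abs, sq_abs]
  have := integral_map hj.aemeasurable hm
  rw [hj.map_eq] at this
  rw [this]
  refine integral_congr_ae ?_
  filter_upwards [hf] with x hx
  rw [hx]

variable (E) in
/-- The space of the square integrable functions represented by elements of the domain. -/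
def l2Dom (hj : MeasurePreserving j μ ν) : Submodule ℝ (Lp ℝ 2 ν) where
  carrier := {f | ∃ u : E.dom, Represents μ j f u}
  add_mem' := by
    rintro f g ⟨u, hu⟩ ⟨v, hv⟩
    exact ⟨u + v, hu.add hj hv⟩
  zero_mem' := ⟨0, represents_zero hj⟩
  smul_mem' := by
    rintro c f ⟨u, hu⟩
    exact ⟨c • u, hu.smul hj c⟩

theorem represents_choose {hj : MeasurePreserving j μ ν} (f : E.l2Dom hj) :
    Represents μ j (f : Lp ℝ 2 ν) f.2.choose := f.2.choose_spec

variable (E) in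
/-- The element of the domain that represents a square integrable function. -/
def rep [μ.IsOpenPosMeasure] (hj : MeasurePreserving j μ ν) : E.l2Dom hj →ₗ[ℝ] E.dom where
  toFun f := f.2.choose
  map_add' f g := (represents_choose (f + g)).unique
    ((represents_choose f).add hj (represents_choose g))
  map_smul' c f := (represents_choose (c • f)).unique ((represents_choose f).smul hj c)

theorem represents_rep [μ.IsOpenPosMeasure] {hj : MeasurePreserving j μ ν} (f : E.l2Dom hj) :
    Represents μ j (f : Lp ℝ 2 ν) (E.rep hj f) := f.2.choose_spec

variable (E) in
/-- The resistance form `E` as a form in `L²`. -/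
def l2Form [μ.IsOpenPosMeasure] (hj : MeasurePreserving j μ ν) : L2Form ν where
  dom := E.l2Dom hj
  form := E.form.compl₁₂ (E.rep hj) (E.rep hj)

theorem exists_represents [μ.IsOpenPosMeasure] {hj : MeasurePreserving j μ ν}
    (f : (E.l2Form hj).dom) : ∃ u : E.dom, Represents μ j (f : Lp ℝ 2 ν) u := f.2

theorem l2Form_form_eq [μ.IsOpenPosMeasure] {hj : MeasurePreserving j μ ν}
    {f g : (E.l2Form hj).dom} {u v : E.dom} (hu : Represents μ j (f : Lp ℝ 2 ν) u)
    (hv : Represents μ j (g : Lp ℝ 2 ν) v) : (E.l2Form hj).form f g = E.form u v := by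
  change E.form (E.rep hj f) (E.rep hj g) = _
  rw [(represents_rep f).unique hu, (represents_rep g).unique hv]

theorem isRealizedBy_l2Form [μ.IsOpenPosMeasure] (hj : MeasurePreserving j μ ν) :
    E.IsRealizedBy μ j (E.l2Form hj) :=
  ⟨fun _ => Iff.rfl, fun _ _ _ _ hu hv => l2Form_form_eq hu hv⟩

theorem energyOne_sub_eq [μ.IsOpenPosMeasure] {hj : MeasurePreserving j μ ν}
    {f g : (E.l2Form hj).dom} {u v : E.dom} (hu : Represents μ j (f : Lp ℝ 2 ν) u)
    (hv : Represents μ j (g : Lp ℝ 2 ν) v) : (E.l2Form hj).energyOne (f - g)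
      = E.form (u - v) (u - v) + ‖(f : Lp ℝ 2 ν) - g‖ ^ 2 := by
  have h : Represents μ j ((f - g : (E.l2Form hj).dom) : Lp ℝ 2 ν) (u - v) := hu.sub hj hv
  rw [L2Form.energyOne, l2Form_form_eq h h]
  rfl

/-! ### Closedness and the Markov property in `L²` -/

theorem l2Form_closed [Nonempty V] [μ.IsOpenPosMeasure] (hj : MeasurePreserving j μ ν)
    (u : ℕ → (E.l2Form hj).dom)
    (hu : ∀ ε > 0, ∃ N, ∀ m ≥ N, ∀ n ≥ N, (E.l2Form hj).energyOne (u m - u n) < ε) :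
    ∃ w : (E.l2Form hj).dom,
      Tendsto (fun n => (E.l2Form hj).energyOne (u n - w)) atTop (𝓝 0) := by
  choose r hr using fun n => exists_represents (u n)
  have hone := fun m n => energyOne_sub_eq (hr m) (hr n)
  obtain ⟨w, hw⟩ := E.complete r (by
    intro ε hε
    obtain ⟨N, hN⟩ := hu ε hε
    refine ⟨N, fun m hm n hn => lt_of_le_of_lt ?_ (hN m hm n hn)⟩
    rw [hone]
    exact le_add_of_nonneg_right (sq_nonneg _))
  have hcs : CauchySeq fun n => (u n : Lp ℝ 2 ν) := by
    rw [Metric.cauchySeq_iff]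
    intro ε hε
    obtain ⟨N, hN⟩ := hu (ε ^ 2) (by positivity)
    refine ⟨N, fun m hm n hn => ?_⟩
    rw [dist_eq_norm]
    refine lt_of_pow_lt_pow_left₀ 2 hε.le (lt_of_le_of_lt ?_ (hN m hm n hn))
    rw [hone]
    exact le_add_of_nonneg_left (E.nonneg _)
  obtain ⟨f, hf⟩ := cauchySeq_tendsto_of_complete hcs
  -- The energy limit `w` is known only modulo constants. Along a subsequence converging almost
  -- everywhere, the value at a single good point `a` supplies the constant.
  obtain ⟨k, hk, hae⟩ := (tendstoInMeasure_of_tendsto_Lp hf).exists_seq_tendsto_ae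
  have hae' : ∀ᵐ x ∂μ, Tendsto (fun i => E.ext (r (k i)) x) atTop (𝓝 (f (j x))) := by
    filter_upwards [hj.quasiMeasurePreserving.ae hae, ae_all_iff.2 hr] with x h1 h2
    exact h1.congr fun i => h2 (k i)
  have hne : Nonempty E.Omega := ‹Nonempty V›.map E.toOmega
  obtain ⟨a, ha⟩ := hae'.exists
  have hfw : Represents μ j f (w + E.const (f (j a) - E.ext w a)) := by
    filter_upwards [hae'] with b hb
    have h1 : Tendsto (fun n => E.ext (r n - w) b - E.ext (r n - w) a) atTop (𝓝 0) := by
      have h2 : Tendsto (fun n => √(dist b a * E.form (r n - w) (r n - w))) atTop (𝓝 0) := by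
        have := (hw.const_mul (dist b a)).sqrt
        simpa using this
      refine squeeze_zero_norm (fun n => ?_) h2
      rw [Real.norm_eq_abs]
      exact Real.abs_le_sqrt (ext_sq_sub_le _ _ _)
    have h3 := h1.comp hk.tendsto_atTop
    have h4 := (hb.sub_const (E.ext w b)).sub (ha.sub_const (E.ext w a))
    have h5 := tendsto_nhds_unique h4 (h3.congr fun n => by simp [ext_sub])
    rw [ext_add, ext_const]
    linarith
  refine ⟨⟨f, _, hfw⟩, ?_⟩
  have hlim : Tendsto (fun n => E.form (r n - w) (r n - w) + ‖(u n : Lp ℝ 2 ν) - f‖ ^ 2)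
      atTop (𝓝 0) := by
    have h1 := (tendsto_iff_norm_sub_tendsto_zero.1 hf).pow 2
    simpa using hw.add h1
  refine hlim.congr fun n => ?_
  rw [energyOne_sub_eq (g := ⟨f, _, hfw⟩) (hr n) hfw, ← sub_sub, form_sub_const]

theorem l2Form_markov [μ.IsOpenPosMeasure] (hj : MeasurePreserving j μ ν)
    (u : (E.l2Form hj).dom) : ∃ v : (E.l2Form hj).dom,
      (v : Lp ℝ 2 ν) =ᵐ[ν] (fun x => unitClip ((u : Lp ℝ 2 ν) x)) ∧
      (E.l2Form hj).form v v ≤ (E.l2Form hj).form u u := by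
  have hc : Continuous unitClip := by unfold unitClip; fun_prop
  have hm : MemLp (fun x => unitClip ((u : Lp ℝ 2 ν) x)) 2 ν := by
    refine (Lp.memLp (u : Lp ℝ 2 ν)).of_le
      (hc.comp_aestronglyMeasurable (Lp.aestronglyMeasurable _)) (Eventually.of_forall fun x => ?_)
    rw [Real.norm_eq_abs, Real.norm_eq_abs, unitClip, abs_of_nonneg (le_max_left _ _)]
    exact max_le (abs_nonneg _) ((min_le_right _ _).trans (le_abs_self _))
  obtain ⟨w, hw⟩ := exists_represents u
  obtain ⟨h, hle⟩ := E.markov w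
  have hrep : Represents μ j (hm.toLp _) ⟨_, h⟩ := by
    filter_upwards [hw, hj.quasiMeasurePreserving.ae_eq_comp hm.coeFn_toLp]
      with x h1 h2
    simp only [Function.comp_apply] at h2
    rw [h2, h1]
    exact (ext_comp (v := ⟨_, h⟩) hc (fun _ => rfl) x).symm
  refine ⟨⟨hm.toLp _, _, hrep⟩, hm.coeFn_toLp, ?_⟩
  rw [l2Form_form_eq hw hw, l2Form_form_eq (f := ⟨hm.toLp _, _, hrep⟩)
    (g := ⟨hm.toLp _, _, hrep⟩) hrep hrep]
  exact hle

theorem isDirichletForm_l2Form [Nonempty V] [μ.IsOpenPosMeasure] (hj : MeasurePreserving j μ ν)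
    (hd : Dense (E.l2Dom hj : Set (Lp ℝ 2 ν))) : (E.l2Form hj).IsDirichletForm where
  dense := hd
  symm _ _ := E.symm _ _
  nonneg _ := E.nonneg _
  closed := l2Form_closed hj
  markov := l2Form_markov hj

/-! ### Continuous functions in the domain -/

section ContinuousDom

variable {X : Type*} [TopologicalSpace X] {j : E.Omega → X}

variable (E j) in
/-- The continuous functions on `X` that are, on `Ω`, extensions of elements of the domain. -/
def continuousDom : Set C(X, ℝ) := {ψ | ∃ u : E.dom, ∀ a, ψ (j a) = E.ext u a}

/-- The Markov property yields two-sided truncations. The upper level `‖ψ‖ + 1` exceeds every value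
of `ψ`, so only the cut at zero is effective; the `+ 1` keeps the interval nondegenerate. -/
theorem posPart_mem_continuousDom [CompactSpace X] {ψ : C(X, ℝ)} (h : ψ ∈ E.continuousDom j) :
    (0 : C(X, ℝ)) ⊔ ψ ∈ E.continuousDom j := by
  obtain ⟨u, hu⟩ := h
  have hb : ∀ x, ψ x ≤ ‖ψ‖ + 1 := fun x =>
    ((le_abs_self _).trans (ψ.norm_coe_le_norm x)).trans (by linarith)
  obtain ⟨v, hv, -⟩ := E.exists_truncation u (show (0 : ℝ) < ‖ψ‖ + 1 by positivity)
  refine ⟨v, fun a => ?_⟩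
  rw [ext_comp (φ := fun t => max 0 (min (‖ψ‖ + 1) t)) (by fun_prop) hv, ← hu a,
    min_eq_right (hb _)]
  rfl

theorem sub_mem_continuousDom {φ ψ : C(X, ℝ)} (hφ : φ ∈ E.continuousDom j)
    (hψ : ψ ∈ E.continuousDom j) : φ - ψ ∈ E.continuousDom j := by
  obtain ⟨u, hu⟩ := hφ
  obtain ⟨v, hv⟩ := hψ
  exact ⟨u - v, fun a => by simp [hu, hv, ext_sub]⟩

theorem add_mem_continuousDom {φ ψ : C(X, ℝ)} (hφ : φ ∈ E.continuousDom j)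
    (hψ : ψ ∈ E.continuousDom j) : φ + ψ ∈ E.continuousDom j := by
  obtain ⟨u, hu⟩ := hφ
  obtain ⟨v, hv⟩ := hψ
  exact ⟨u + v, fun a => by simp [hu, hv, ext_add]⟩

/-- If the continuous functions in the domain separate points, they are uniformly dense. -/
theorem dense_continuousDom [CompactSpace X]
    (hsep : ∀ x y : X, x ≠ y → ∃ ψ ∈ E.continuousDom j, ψ x ≠ ψ y) :
    Dense (E.continuousDom j) := by
  rw [dense_iff_closure_eq]
  refine ContinuousMap.sublattice_closure_eq_top _ ⟨0, 0, fun a => ?_⟩ (fun f hf g hg => ?_)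
    (fun f hf g hg => ?_) fun v x y => ?_
  · simpa using (ext_smul (0 : ℝ) (0 : E.dom) a).symm
  · have := sub_mem_continuousDom hf (posPart_mem_continuousDom (sub_mem_continuousDom hf hg))
    convert this using 1
    ext x
    simp only [ContinuousMap.inf_apply, ContinuousMap.sub_apply, ContinuousMap.sup_apply,
      ContinuousMap.zero_apply]
    rcases le_total (f x) (g x) with h | h
    · rw [min_eq_left h, max_eq_left (by linarith)]; ring
    · rw [min_eq_right h, max_eq_right (by linarith)]; ring
  · have := add_mem_continuousDom hg (posPart_mem_continuousDom (sub_mem_continuousDom hf hg))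
    convert this using 1
    ext x
    simp only [ContinuousMap.sup_apply, ContinuousMap.sub_apply, ContinuousMap.add_apply,
      ContinuousMap.zero_apply]
    rcases le_total (f x) (g x) with h | h
    · rw [max_eq_right h, max_eq_left (by linarith)]; ring
    · rw [max_eq_left h, max_eq_right (by linarith)]; ring
  · by_cases hxy : x = y
    · exact ⟨ContinuousMap.const X (v x), ⟨E.const (v x), fun a => by simp [ext_const]⟩,
        rfl, by simp [hxy]⟩
    · obtain ⟨ψ, ⟨u, hu⟩, hne⟩ := hsep x y hxy
      set t := (v y - v x) / (ψ y - ψ x)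
      refine ⟨ContinuousMap.const X (v x - t * ψ x) + t • ψ,
        ⟨E.const (v x - t * ψ x) + t • u, fun a => ?_⟩, ?_, ?_⟩
      · simp [ext_add, ext_smul, ext_const, hu]
      · simp
      · have : ψ y - ψ x ≠ 0 := sub_ne_zero.2 hne.symm
        have ht : t * (ψ y - ψ x) = v y - v x := div_mul_cancel₀ _ this
        simp only [ContinuousMap.add_apply, ContinuousMap.const_apply, ContinuousMap.smul_apply,
          smul_eq_mul]
        linarith

end ContinuousDom

/-! ### Density of the domain in `L²` -/

theorem represents_toLp [TopologicalSpace X] [CompactSpace X] [BorelSpace X] [IsFiniteMeasure ν] (hj : MeasurePreserving j μ ν)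
    {ψ : C(X, ℝ)} {u : E.dom} (hψ : ∀ a, ψ (j a) = E.ext u a) :
    Represents μ j (ContinuousMap.toLp 2 ν ℝ ψ) u := by
  filter_upwards [hj.quasiMeasurePreserving.ae_eq_comp (ContinuousMap.coeFn_toLp (p := 2) (𝕜 := ℝ) ν ψ)]
    with x hx
  exact hx.trans (hψ x)

/-- Uniform density in `C(Y)` gives density in `L²(κ)`, and composition with `i` carries this onto
`L²(ν)`. Compactness is thus needed of `Y` only, not of `X`. -/
theorem dense_l2Dom_of_dense {Y : Type*} [TopologicalSpace Y] [CompactSpace Y] [NormalSpace Y]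
    [MeasurableSpace Y] [BorelSpace Y] {κ : Measure Y} [IsFiniteMeasure κ] [κ.WeaklyRegular]
    {i : X → Y} (hi : MeasurableEmbedding i) (hiκ : MeasurePreserving i ν κ)
    (hj : MeasurePreserving j μ ν) (hd : Dense (E.continuousDom (i ∘ j))) :
    Dense (E.l2Dom hj : Set (Lp ℝ 2 ν)) := by
  have h1 := (ContinuousMap.toLp_denseRange ℝ κ (p := 2) ℝ (by simp)).dense_image
    (ContinuousLinearMap.continuous _) hd
  have h2 := (Lp.compMeasurePreserving_surjective hi hiκ).denseRange.dense_image
    (Lp.isometry_compMeasurePreserving hiκ).continuous h1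
  refine h2.mono ?_
  rintro _ ⟨_, ⟨φ, ⟨u, hu⟩, rfl⟩, rfl⟩
  refine ⟨u, ?_⟩
  filter_upwards [hj.quasiMeasurePreserving.ae_eq_comp (Lp.coeFn_compMeasurePreserving
    (ContinuousMap.toLp 2 κ ℝ φ) hiκ), represents_toLp (hiκ.comp hj) hu] with x h1 h2
  exact h1.trans h2

end ResistanceForm

/-! ### Locality and regularity -/

namespace ResistanceForm

variable {V : Type*} {E : ResistanceForm V} {X : Type*} [TopologicalSpace X] [MeasurableSpace X]
  {μ : Measure E.Omega} {ν : Measure X} {j : E.Omega → X}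

/-- A represented function that vanishes almost everywhere off a closed set is represented by a
function that vanishes everywhere off this set. -/
theorem Represents.eq_zero_of_notMem [μ.IsOpenPosMeasure] (hj : MeasurePreserving j μ ν)
    (hc : Continuous j) {f : Lp ℝ 2 ν} {u : E.dom} (hu : Represents μ j f u) {K : Set X}
    (hK : IsClosed K) (h : ∀ᵐ x ∂ν, x ∉ K → f x = 0) {a : E.Omega} (ha : j a ∉ K) :
    E.ext u a = 0 := by
  by_contra hne
  -- The set where the assertion fails is open and null, hence empty by full support.
  have hopen : IsOpen (j ⁻¹' Kᶜ ∩ {a | E.ext u a ≠ 0}) :=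
    (hK.isOpen_compl.preimage hc).inter (isOpen_ne_fun (E.continuous_ext u) continuous_const)
  have hnull : μ (j ⁻¹' Kᶜ ∩ {a | E.ext u a ≠ 0}) = 0 := by
    rw [measure_eq_zero_iff_ae_notMem]
    filter_upwards [hu, hj.quasiMeasurePreserving.ae h] with x h1 h2 h3
    exact h3.2 (h1.symm.trans (h2 h3.1))
  exact ((hopen.measure_eq_zero_iff μ).1 hnull).subset ⟨ha, hne⟩

theorem isOpenPosMeasure_of_measurePreserving [OpensMeasurableSpace X] [μ.IsOpenPosMeasure]
    (hj : MeasurePreserving j μ ν) (hc : Continuous j) (hd : DenseRange j) :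
    ν.IsOpenPosMeasure where
  open_pos U hU hne := by
    rw [← hj.measure_preimage hU.measurableSet.nullMeasurableSet]
    obtain ⟨a, ha⟩ := hd.exists_mem_open hU hne
    exact (hU.preimage hc).measure_ne_zero μ ⟨a, ha⟩

end ResistanceForm

namespace FinitelyRamifiedCellStructure

variable {F : Type*} [MetricSpace F] {A : Type*} {C : FinitelyRamifiedCellStructure F A}
  {E : ResistanceForm C.vertices}

/-- The energy of functions with disjoint compact supports in `F` vanishes. -/
theorem form_eq_zero_of_disjoint (hE : C.IsCompatible E) {u v : E.dom} {K L : Set F}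
    (hK : IsCompact K) (hL : IsCompact L) (hKL : Disjoint K L)
    (hu : ∀ p : C.vertices, (p : F) ∉ K → (u : C.vertices → ℝ) p = 0)
    (hv : ∀ p : C.vertices, (p : F) ∉ L → (v : C.vertices → ℝ) p = 0) : E.form u v = 0 := by
  obtain ⟨δ, hδ, hdisj⟩ := hKL.exists_thickenings hK hL.isClosed
  obtain ⟨n, hn⟩ := C.exists_level_dist_lt hδ
  refine form_eq_zero_of_forall_or hE (n := n) fun m hm α hα => ?_
  by_contra! h
  obtain ⟨⟨p, hpα, hp⟩, q, hqα, hq⟩ := h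
  have hpK : (p : F) ∈ K := by_contra fun h => hp (hu p h)
  have hqL : (q : F) ∈ L := by_contra fun h => hq (hv q h)
  exact Set.disjoint_left.1 hdisj (Metric.self_subset_thickening hδ K hpK)
    (Metric.mem_thickening_iff.2
      ⟨q, hqL, hn m hm α hα p (C.vert_subset α hpα) q (C.vert_subset α hqα)⟩)

/-- The map `i` sends disjoint compact subsets of `X` to disjoint compact subsets of `F`, where the
cells decide; no local compactness of `X` enters. -/
theorem isLocal_l2Form {X : Type*} [TopologicalSpace X] [T2Space X] [MeasurableSpace X]
    {μ : Measure E.Omega} [μ.IsOpenPosMeasure] {ν : Measure X} {j : E.Omega → X} {i : X → F}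
    (hE : C.IsCompatible E) (hj : MeasurePreserving j μ ν) (hjc : Continuous j)
    (hic : Continuous i) (hi : Function.Injective i)
    (hij : ∀ p : C.vertices, i (j (E.toOmega p)) = p) : (E.l2Form hj).IsLocal := by
  intro f g K L hK hL hKL hf hg
  obtain ⟨u, hu⟩ := ResistanceForm.exists_represents f
  obtain ⟨v, hv⟩ := ResistanceForm.exists_represents g
  rw [ResistanceForm.l2Form_form_eq hu hv]
  refine form_eq_zero_of_disjoint hE (hK.image hic) (hL.image hic)
    ((disjoint_image_iff hi).2 hKL) (fun p hp => ?_) fun p hp => ?_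
  · rw [← E.ext_toOmega]
    exact hu.eq_zero_of_notMem hj hjc hK.isClosed hf fun h => hp ⟨_, h, hij p⟩
  · rw [← E.ext_toOmega]
    exact hv.eq_zero_of_notMem hj hjc hL.isClosed hg fun h => hp ⟨_, h, hij p⟩

/-! ### Approximation by bounded and by harmonic functions -/

/-- Every function in the domain is approximated by bounded functions in the domain that are
pointwise smaller. -/
theorem exists_seq_bounded (u : E.dom) : ∃ v : ℕ → E.dom,
    (∀ n, ∃ M > 0, ∀ p, |(v n : C.vertices → ℝ) p| ≤ M) ∧
    Tendsto (fun n => E.form (u - v n) (u - v n)) atTop (𝓝 0) ∧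
    (∀ a, Tendsto (fun n => E.ext (v n) a) atTop (𝓝 (E.ext u a))) ∧
    ∀ n a, |E.ext (v n) a| ≤ |E.ext u a| := by
  choose h hh hhu using fun n => exists_harmonic E n (u : C.vertices → ℝ)
  have hlim := tendsto_form_sub_harmonic hh hhu
  have hbdd : ∀ n : ℕ, ∃ M : ℝ, (n : ℝ) < M ∧
      ∀ p ∈ C.verticesAt n, |(u : C.vertices → ℝ) p| ≤ M := by
    intro n
    obtain ⟨B, hB⟩ := ((C.finite_verticesAt n).image
      fun p => |(u : C.vertices → ℝ) p|).bddAbove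
    -- The level must dominate `u` on `V_n`, so that truncation keeps these values and the
    -- comparison with the harmonic function applies, and must tend to infinity for pointwise
    -- convergence.
    refine ⟨max B (n + 1), lt_max_of_lt_right (by linarith), fun p hp => ?_⟩
    exact (hB ⟨p, hp, rfl⟩).trans (le_max_left _ _)
  choose M hnM hM using hbdd
  have hM0 : ∀ n, 0 < M n := fun n => (Nat.cast_nonneg n).trans_lt (hnM n)
  choose v hv hle using fun n => E.exists_truncation u (show -M n < M n by linarith [hM0 n])
  have hext : ∀ n a, E.ext (v n) a = max (-M n) (min (M n) (E.ext u a)) := fun n a =>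
    ResistanceForm.ext_comp (φ := fun t => max (-M n) (min (M n) t)) (by fun_prop) (hv n) a
  refine ⟨v, fun n => ⟨M n, hM0 n, fun p => ?_⟩, ?_, fun a => ?_, fun n a => ?_⟩
  · rw [hv, abs_le]
    exact ⟨le_max_left _ _, max_le (by linarith [hM0 n]) (min_le_left _ _)⟩
  · refine squeeze_zero (fun _ => E.nonneg _) (fun n => ?_)
      ((hlim.const_mul 4).trans (by rw [mul_zero]))
    refine ResistanceForm.IsEnergyMinimizer.form_sub_le (hh n) (fun p hp => (hhu n p hp).symm)
      (fun p hp => ?_) (hle n)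
    have := abs_le.1 (hM n p hp)
    rw [hv, hhu n p hp, min_eq_right this.2, max_eq_right this.1]
  · refine tendsto_const_nhds.congr' ?_
    obtain ⟨N, hN⟩ := exists_nat_ge |E.ext u a|
    filter_upwards [eventually_ge_atTop N] with n hn
    have : |E.ext u a| ≤ M n := hN.trans ((Nat.cast_le.2 hn).trans (hnM n).le)
    rw [hext, min_eq_right (abs_le.1 this).2, max_eq_right (abs_le.1 this).1]
  · rw [hext, abs_le]
    have h1 := neg_abs_le (E.ext u a)
    have h2 := le_abs_self (E.ext u a)
    have h3 := abs_nonneg (E.ext u a)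
    have h4 := hM0 n
    constructor
    · rcases le_total (M n) (E.ext u a) with h | h
      · rw [min_eq_left h]; exact le_max_of_le_right (by linarith)
      · rw [min_eq_right h]; exact le_max_of_le_right h1
    · exact max_le (by linarith) ((min_le_right _ _).trans h2)

/-- All differences `u - h n` vanish at a common vertex of `V_0`; the resistance estimate anchored
there converts energy convergence into pointwise convergence. -/
theorem tendsto_ext_harmonic {u : E.dom} {h : ℕ → E.dom} (hh : ∀ n, C.IsHarmonic E n (h n))
    (hu : ∀ n, ∀ p ∈ C.verticesAt n, (h n : C.vertices → ℝ) p = (u : C.vertices → ℝ) p)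
    (a : E.Omega) : Tendsto (fun n => E.ext (h n) a) atTop (𝓝 (E.ext u a)) := by
  obtain ⟨q, hq⟩ := C.verticesAt_zero_nonempty
  rw [tendsto_iff_dist_tendsto_zero]
  have h1 := ((tendsto_form_sub_harmonic hh hu).const_mul (dist a (E.toOmega q))).sqrt
  rw [mul_zero, Real.sqrt_zero] at h1
  refine squeeze_zero (fun _ => dist_nonneg) (fun n => ?_) h1
  rw [dist_comm, Real.dist_eq]
  apply Real.abs_le_sqrt
  have := ResistanceForm.ext_sq_sub_le (u - h n) a (E.toOmega q)
  rwa [ResistanceForm.ext_sub, ResistanceForm.ext_sub, E.ext_toOmega, E.ext_toOmega,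
    hu n q (C.verticesAt_mono (Nat.zero_le n) hq), sub_self, sub_zero] at this

theorem abs_ext_le {u : E.dom} {M : ℝ} (h : ∀ p, |(u : C.vertices → ℝ) p| ≤ M) (a : E.Omega) :
    |E.ext u a| ≤ M := by
  refine ResistanceForm.denseRange_toOmega.induction_on (p := fun a => |E.ext u a| ≤ M) a
    (isClosed_le (E.continuous_ext u).abs continuous_const) fun p => ?_
  rw [E.ext_toOmega]
  exact h p

/-- The harmonic functions are dense in the domain, in the norm of `𝓔₁`. -/
theorem exists_harmonic_near {μ : Measure E.Omega} [IsFiniteMeasure μ] {u : E.dom}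
    (hu : MemLp (E.ext u) 2 μ) {ε : ℝ} (hε : 0 < ε) : ∃ (n : ℕ) (h : E.dom), C.IsHarmonic E n h ∧
      E.form (u - h) (u - h) + ∫ x, E.ext (u - h) x ^ 2 ∂μ < ε := by
  obtain ⟨v, hvb, hvE, hvt, hvle⟩ := exists_seq_bounded u
  have hv2 : Tendsto (fun n => ∫ x, E.ext (u - v n) x ^ 2 ∂μ) atTop (𝓝 0) := by
    have := tendsto_integral_of_dominated_convergence (μ := μ)
      (F := fun n x => E.ext (u - v n) x ^ 2) (f := fun _ => 0)
      (fun x => 4 * E.ext u x ^ 2)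
      (fun n => ((E.continuous_ext _).pow 2).aestronglyMeasurable) (hu.integrable_sq.const_mul 4)
      (fun n => Eventually.of_forall fun x => ?_) (Eventually.of_forall fun x => ?_)
    · simpa using this
    · rw [ResistanceForm.ext_sub, Real.norm_eq_abs, abs_of_nonneg (sq_nonneg _)]
      have := sq_le_sq.2 (hvle n x)
      nlinarith [sq_nonneg (E.ext u x + E.ext (v n) x)]
    · have := ((hvt x).const_sub (E.ext u x)).pow 2
      simpa [ResistanceForm.ext_sub] using this
  -- Two approximations within `ε / 4` suffice, as each enters the final estimate with a factor `2`
  -- from the inequality for the square of a sum.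
  obtain ⟨n, hn⟩ := ((hvE.add hv2).eventually
    (gt_mem_nhds (show 0 + 0 < ε / 4 by simpa using by positivity))).exists
  obtain ⟨M, hM, hvM⟩ := hvb n
  choose h hh hhv using fun k => exists_harmonic E k (v n : C.vertices → ℝ)
  -- The reason for truncating first: by the maximum principle the harmonic approximations inherit
  -- the bound `M`, and a constant dominates on a finite measure space.
  have hhM : ∀ k a, |E.ext (h k) a| ≤ M := fun k => abs_ext_le
    (ResistanceForm.IsEnergyMinimizer.abs_le (C.verticesAt_nonempty k) (hh k) hM
      fun p hp => by rw [hhv k p hp]; exact hvM p)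
  have hvM' := fun a => abs_ext_le hvM a
  have hh2 : Tendsto (fun k => ∫ x, E.ext (v n - h k) x ^ 2 ∂μ) atTop (𝓝 0) := by
    have := tendsto_integral_of_dominated_convergence (μ := μ)
      (F := fun k x => E.ext (v n - h k) x ^ 2) (f := fun _ => 0)
      (fun x => (2 * M) ^ 2)
      (fun n => ((E.continuous_ext _).pow 2).aestronglyMeasurable) (integrable_const _)
      (fun k => Eventually.of_forall fun x => ?_) (Eventually.of_forall fun x => ?_)
    · simpa using this
    · rw [ResistanceForm.ext_sub, Real.norm_eq_abs, abs_of_nonneg (sq_nonneg _)]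
      refine sq_le_sq' ?_ ?_ <;> linarith [abs_le.1 (hhM k x), abs_le.1 (hvM' x)]
    · have := ((tendsto_ext_harmonic hh hhv x).const_sub (E.ext (v n) x)).pow 2
      simpa [ResistanceForm.ext_sub] using this
  obtain ⟨k, hk⟩ := (((tendsto_form_sub_harmonic hh hhv).add hh2).eventually
    (gt_mem_nhds (show 0 + 0 < ε / 4 by simpa using by positivity))).exists
  refine ⟨k, h k, hh k, ?_⟩
  have hbm : ∀ {w : E.dom} {B : ℝ}, (∀ a, |E.ext w a| ≤ B) → MemLp (E.ext w) 2 μ := fun hw =>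
    MemLp.of_bound (E.continuous_ext _).aestronglyMeasurable _ (Eventually.of_forall hw)
  have i1 : Integrable (fun x => E.ext (u - v n) x ^ 2) μ := by
    have := (hu.sub (hbm hvM')).integrable_sq
    exact this.congr (Eventually.of_forall fun x => by simp [ResistanceForm.ext_sub])
  have i2 : Integrable (fun x => E.ext (v n - h k) x ^ 2) μ := by
    have := ((hbm hvM').sub (hbm (hhM k))).integrable_sq
    exact this.congr (Eventually.of_forall fun x => by simp [ResistanceForm.ext_sub])
  have i3 : Integrable (fun x => E.ext (u - h k) x ^ 2) μ := by
    have := (hu.sub (hbm (hhM k))).integrable_sq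
    exact this.congr (Eventually.of_forall fun x => by simp [ResistanceForm.ext_sub])
  have hint : ∫ x, E.ext (u - h k) x ^ 2 ∂μ
      ≤ 2 * ∫ x, E.ext (u - v n) x ^ 2 ∂μ + 2 * ∫ x, E.ext (v n - h k) x ^ 2 ∂μ := by
    rw [← integral_const_mul, ← integral_const_mul,
      ← integral_add (i1.const_mul 2) (i2.const_mul 2)]
    refine integral_mono i3 ((i1.const_mul 2).add (i2.const_mul 2)) fun x => ?_
    simp only [ResistanceForm.ext_sub]
    nlinarith [sq_nonneg (E.ext u x - E.ext (v n) x - (E.ext (v n) x - E.ext (h k) x))]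
  linarith [E.form_sub_self_le u (v n) (h k)]

/-- Harmonic functions have continuous versions, automatically of compact support, and approximate
in `𝓔₁`; uniform density is the Stone-Weierstrass hypothesis `hd`. -/
theorem isRegular_l2Form {X : Type*} [TopologicalSpace X] [CompactSpace X] [T2Space X]
    [MeasurableSpace X] [BorelSpace X] {μ : Measure E.Omega} [IsFiniteMeasure μ]
    [μ.IsOpenPosMeasure] {ν : Measure X} {j : E.Omega → X} (hj : MeasurePreserving j μ ν)
    (hjc : Continuous j) (hjd : DenseRange j)
    (hharm : ∀ (n : ℕ) (u : E.dom), C.IsHarmonic E n u → ∃ ψ : C(X, ℝ), ∀ a, ψ (j a) = E.ext u a)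
    (hd : Dense (E.continuousDom j)) : (E.l2Form hj).IsRegular := by
  have hfin : IsFiniteMeasure ν := hj.map_eq ▸ inferInstance
  have hver : ∀ (ψ : C(X, ℝ)) (h : ∃ u : E.dom, ∀ a, ψ (j a) = E.ext u a),
      ∃ v : (E.l2Form hj).dom, (E.l2Form hj).IsVersion v ψ ∧
        (v : Lp ℝ 2 ν) = ContinuousMap.toLp 2 ν ℝ ψ := by
    rintro ψ ⟨u, hu⟩
    exact ⟨⟨ContinuousMap.toLp 2 ν ℝ ψ, u, ResistanceForm.represents_toLp hj hu⟩,
      ⟨ψ.continuous, HasCompactSupport.of_compactSpace _, ContinuousMap.coeFn_toLp ν ψ⟩, rfl⟩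
  refine ⟨inferInstance, inferInstance,
    ResistanceForm.isOpenPosMeasure_of_measurePreserving hj hjc hjd, fun f ε hε => ?_,
    fun ψ hψ _ ε hε => ?_⟩
  · obtain ⟨u, hu⟩ := ResistanceForm.exists_represents f
    obtain ⟨n, h, hh, hlt⟩ := exists_harmonic_near (hu.memLp hj) hε
    obtain ⟨ψ, hψ⟩ := hharm n h hh
    obtain ⟨v, hv, hvψ⟩ := hver ψ ⟨h, hψ⟩
    have hvh : ResistanceForm.Represents μ j (v : Lp ℝ 2 ν) h :=
      hvψ ▸ ResistanceForm.represents_toLp hj hψ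
    refine ⟨v, ψ, hv, ?_⟩
    rw [ResistanceForm.energyOne_sub_eq hu hvh, (hu.sub hj hvh).norm_sq hj]
    exact hlt
  · obtain ⟨φ, hφ, hdist⟩ := hd.exists_dist_lt ⟨ψ, hψ⟩ hε
    obtain ⟨v, hv, -⟩ := hver φ hφ
    refine ⟨v, φ, hv, fun x => ?_⟩
    have := (ContinuousMap.dist_apply_le_dist (f := (⟨ψ, hψ⟩ : C(X, ℝ))) (g := φ) x).trans_lt hdist
    rwa [Real.dist_eq] at this

/-- The realization of the resistance form in `L²(X, ν)`, where `X` lies between `Ω` and `F`. -/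
theorem isDirichletForm_isLocal_isRegular_l2Form [CompactSpace F] [MeasurableSpace F]
    [BorelSpace F] (hE : C.IsCompatible E)
    (hcont : ∀ (n : ℕ) (u : E.dom), C.IsHarmonic E n u →
      ∃ φ : C(F, ℝ), ∀ p : C.vertices, φ p = (u : C.vertices → ℝ) p)
    {X : Type*} [TopologicalSpace X] [PolishSpace X] [MeasurableSpace X] [BorelSpace X]
    {μ : Measure E.Omega} [IsFiniteMeasure μ] [μ.IsOpenPosMeasure] {ν : Measure X}
    {j : E.Omega → X} {i : X → F} (hj : MeasurePreserving j μ ν) (hjc : Continuous j)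
    (hjd : DenseRange j) (hic : Continuous i) (hi : Function.Injective i)
    (hij : ∀ p : C.vertices, i (j (E.toOmega p)) = p) :
    (E.l2Form hj).IsDirichletForm ∧ (E.l2Form hj).IsLocal ∧
      (CompactSpace X → (E.l2Form hj).IsRegular) := by
  have hne : Nonempty C.vertices := C.verticesAt_zero_nonempty.to_subtype.map Subtype.val
  have hext : ∀ (u : E.dom) (φ : C(F, ℝ)), (∀ p : C.vertices, φ p = (u : C.vertices → ℝ) p) →
      ∀ a, φ (i (j a)) = E.ext u a := fun u φ hφ => congrFun <|
    ResistanceForm.ext_unique u (φ.continuous.comp (hic.comp hjc)) fun p => by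
      simp only [hij, hφ]
  have hfin : IsFiniteMeasure ν := hj.map_eq ▸ inferInstance
  have hdF : Dense (E.continuousDom (i ∘ j)) :=
    ResistanceForm.dense_continuousDom fun x y hxy => by
      obtain ⟨u, φ, hφ, hne⟩ := exists_harmonic_ne hE hcont hxy
      exact ⟨φ, ⟨u, hext u φ hφ⟩, hne⟩
  -- Lusin-Souslin: a continuous injection of a Polish space is a Borel embedding, although `i` need
  -- not be a topological one.
  have him : MeasurableEmbedding i := hic.measurableEmbedding hi
  refine ⟨ResistanceForm.isDirichletForm_l2Form hj
    (ResistanceForm.dense_l2Dom_of_dense him (him.measurable.measurePreserving ν) hj hdF),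
    isLocal_l2Form hE hj hjc hic hi hij, fun _ => ?_⟩
  refine isRegular_l2Form (C := C) hj hjc hjd (fun n u hu => ?_)
    (ResistanceForm.dense_continuousDom fun x y hxy => ?_)
  · obtain ⟨φ, hφ⟩ := hcont n u hu
    exact ⟨φ.comp ⟨i, hic⟩, hext u φ hφ⟩
  · obtain ⟨u, φ, hφ, hne⟩ := exists_harmonic_ne hE hcont (hi.ne hxy)
    exact ⟨φ.comp ⟨i, hic⟩, ⟨u, hext u φ hφ⟩, hne⟩

end FinitelyRamifiedCellStructure

end

theorem mainTheorem5 {F A : Type*} [MetricSpace F] [CompactSpace F]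
    [MeasurableSpace F] [BorelSpace F]
    (C : FinitelyRamifiedCellStructure F A) (E : ResistanceForm C.vertices)
    (hE : C.IsCompatible E)
    (hcont : ∀ (n : ℕ) (u : E.dom), C.IsHarmonic E n u →
      ∃ φ : C(F, ℝ), ∀ p : C.vertices, φ p = (u : C.vertices → ℝ) p) :
    ∃ θ : E.Omega → F, Continuous θ ∧ Function.Injective θ ∧
      (∀ p : C.vertices, θ (E.toOmega p) = p) ∧
      ∀ (μ : Measure E.Omega) [IsFiniteMeasure μ] [μ.IsOpenPosMeasure],
        (∃ D : L2Form μ, E.IsRealizedBy μ id D ∧ D.IsDirichletForm ∧ D.IsLocal ∧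
          (CompactSpace E.Omega → D.IsRegular)) ∧
        (∃ D : L2Form (μ.map θ), E.IsRealizedBy μ θ D ∧ D.IsDirichletForm ∧ D.IsLocal ∧
          D.IsRegular) := by
  obtain ⟨θ, hθ, hinj, hθV⟩ := C.exists_embedding hE hcont
  refine ⟨θ, hθ, hinj, hθV, fun μ _ _ => ⟨?_, ?_⟩⟩
  · have := C.countable_vertices
    have : TopologicalSpace.SeparableSpace E.Omega :=
      .of_denseRange E.toOmega ResistanceForm.denseRange_toOmega
    have : SecondCountableTopology E.Omega := UniformSpace.secondCountable_of_separable _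
    have hj : MeasurePreserving (id : E.Omega → E.Omega) μ μ := .id μ
    exact ⟨E.l2Form hj, ResistanceForm.isRealizedBy_l2Form hj,
      C.isDirichletForm_isLocal_isRegular_l2Form hE hcont hj continuous_id denseRange_id hθ hinj
        hθV⟩
  · have hj : MeasurePreserving θ μ (μ.map θ) := hθ.measurable.measurePreserving μ
    have hd : DenseRange θ := C.dense_vertices.mono fun x hx => ⟨E.toOmega ⟨x, hx⟩, hθV ⟨x, hx⟩⟩
    obtain ⟨h1, h2, h3⟩ := FinitelyRamifiedCellStructure.isDirichletForm_isLocal_isRegular_l2Form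
      hE hcont hj hθ hd continuous_id Function.injective_id hθV
    exact ⟨E.l2Form hj, ResistanceForm.isRealizedBy_l2Form hj, h1, h2, h3 inferInstance⟩
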